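/- Let $\mathbb{K}$ be a field of characteristic $0$, let $q\in\mathbb{K}^\times$ not be a root of unity, let $I$ be a finite set with a total order $<$, and let $(d_{ij})_{i,j\in I}$ be a symmetric Cartan matrix, i.e. $d_{ii}=2$ and $d_{ij}=d_{ji}\in\{0,-1,-2,\dots\}$ for $i\neq j$. Put $\zeta_{ij}(x)=\frac{x-q^{-d_{ij}}}{x-1}$. Let $\widetilde U^+_q(L\mathfrak g)$ be the $\mathbb{K}$-algebra generated by $e_{i,k}$ ($i\in I$, $k\in\mathbb{Z}$) with the relations $$e_i(z)e_j(w)(z-wq^{d_{ij}})=e_j(w)e_i(z)(zq^{d_{ij}}-w),\qquad e_i(z)=\sum_{k\in\mathbb{Z}}e_{i,k}z^{-k},\qquad i,j\in I,$$ and let $\widetilde U^-_q(L\mathfrak g)$ be the $\mathbb{K}$-algebra generated by $f_{i,k}$ ($i\in I$, $k\in\mathbb{Z}$) with the relations $$f_i(z)f_j(w)(z-wq^{-d_{ij}})=f_j(w)f_i(z)(zq^{-d_{ij}}-w),\qquad f_i(z)=\sum_{k\in\mathbb{Z}}f_{i,k}z^{-k},\qquad i,j\in I$$ (in both cases one equates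 the coefficients of all monomials in $z,w$). Let $$\mathcal V^+=\mathcal V^-=\bigoplus_{\boldsymbol n\in\mathbb{N}^I}\mathcal V_{\boldsymbol n},\qquad \mathcal V_{\boldsymbol n}=\frac{\mathbb{K}[z_{i1}^{\pm1},\dots,z_{in_i}^{\pm1}]_{i\in I}^{\mathrm{sym}}}{\prod_{i<j}\prod_{a\le n_i,\,b\le n_j}(z_{ia}-z_{jb})},$$ where "sym" denotes Laurent polynomials symmetric in $z_{i1},\dots,z_{in_i}$ for each $i\in I$ separately (only the vector space structure of $\mathcal V^\pm$ is used). For a rational function $F(z_1,\dots,z_m)$ let $\int_{|z_1|\gg\dots\gg|z_m|}F$ (respectively $\int_{|z_1|\ll\dots\ll|z_m|}F$) be the constant term of the expansion of $F$ in powers of $\frac{z_2}{z_1},\dots,\frac{z_m}{z_{m-1}}$ (respectively $\frac{z_1}{z_2},\dots,\frac{z_{m-1}}{z_m}$), i.e. of its iterated Laurent series expansion in that region. Then there are unique bilinear pairings $$\widetilde U^+_q(L\mathfrak g)\otimes\mathcal V^-\xrightarrow{\langle\cdot,\cdot\rangle_{\widetilde U\mathcal V}}\mathbb{K},\qquad \mathcal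 V^+\otimes\widetilde U^-_q(L\mathfrak g)\xrightarrow{\langle\cdot,\cdot\rangle_{\mathcal V\widetilde U}}\mathbb{K}$$ such that, for all $m\ge 0$, $i_1,\dots,i_m\in I$, $k_1,\dots,k_m\in\mathbb{Z}$, $\boldsymbol n\in\mathbb{N}^I$ and $R\in\mathcal V_{\boldsymbol n}$, $$\langle e_{i_1,k_1}\cdots e_{i_m,k_m},R\rangle_{\widetilde U\mathcal V}=\int_{|z_1|\gg\dots\gg|z_m|}\frac{z_1^{k_1}\cdots z_m^{k_m}R(z_1,\dots,z_m)}{\prod_{1\le a<b\le m}\zeta_{i_bi_a}(z_b/z_a)},$$ $$\langle R,f_{i_1,-k_1}\cdots f_{i_m,-k_m}\rangle_{\mathcal V\widetilde U}=\int_{|z_1|\ll\dots\ll|z_m|}\frac{z_1^{-k_1}\cdots z_m^{-k_m}R(z_1,\dots,z_m)}{\prod_{1\le a<b\le m}\zeta_{i_ai_b}(z_a/z_b)}$$ if $n_i=|\{a: i_a=i\}|$ for all $i\in I$, and both are $0$ otherwise; here the variables $z_{i\bullet}$ of $R$ are replaced by $z_1,\dots,z_m$ through any bijection that sends, for each $a$,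 some $z_{i_a\bullet}$ to $z_a$ (the values do not depend on this choice). Both pairings are non-degenerate in both arguments: an element of either factor that pairs to $0$ with every element of the other factor is $0$. -/

import Mathlib

namespace QuantumLoop

/-- A symmetric Cartan matrix: `d i i = 2`, and `d i j = d j i ∈ {0, -1, -2, …}` for `i ≠ j`. -/
structure IsSymmetricCartan {I : Type*} (d : Matrix I I ℤ) : Prop where
  diag : ∀ i, d i i = 2
  symm : ∀ i j, d i j = d j i
  nonpos : ∀ i j, i ≠ j → d i j ≤ 0

section QuadraticAlgebras

variable {K : Type*} [Field K] {I : Type*}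

/-- The free generator with index `(i, k)` of `K⟨x_{i,k}⟩`, where `i ∈ I` and `k ∈ ℤ`. -/
def gen (K : Type*) [Field K] {I : Type*} (i : I) (k : ℤ) : FreeAlgebra K (I × ℤ) :=
  FreeAlgebra.ι K (i, k)

/-- The relations
`e_i(z) e_j(w) (z - w q^{d_ij}) = e_j(w) e_i(z) (z q^{d_ij} - w)`,
where `e_i(z) = ∑_k e_{i,k} z^{-k}`: for each `k, l` one equates the coefficients of
`z^{-k} w^{-l}` on the two sides. -/
inductive RelPlus (d : Matrix I I ℤ) (q : K) :
    FreeAlgebra K (I × ℤ) → FreeAlgebra K (I × ℤ) → Prop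
  | quad (i j : I) (k l : ℤ) : RelPlus d q
      (gen K i (k + 1) * gen K j l - q ^ d i j • (gen K i k * gen K j (l + 1)))
      (q ^ d i j • (gen K j l * gen K i (k + 1)) - gen K j (l + 1) * gen K i k)

/-- The relations `f_i(z) f_j(w) ζ_ij(z/w) = f_j(w) f_i(z) ζ_ji(w/z)` with denominators cleared,
`f_i(z) f_j(w) (z - w q^{-d_ij}) = f_j(w) f_i(z) (z q^{-d_ij} - w)`,
where `f_i(z) = ∑_k f_{i,k} z^{-k}`: for each `k, l` one equates the coefficients of
`z^{-k} w^{-l}` on the two sides. -/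
inductive RelMinus (d : Matrix I I ℤ) (q : K) :
    FreeAlgebra K (I × ℤ) → FreeAlgebra K (I × ℤ) → Prop
  | quad (i j : I) (k l : ℤ) : RelMinus d q
      (gen K i (k + 1) * gen K j l - q ^ (-d i j) • (gen K i k * gen K j (l + 1)))
      (q ^ (-d i j) • (gen K j l * gen K i (k + 1)) - gen K j (l + 1) * gen K i k)

/-- The quadratic algebra `Ũ_q^+(Lg)`. -/
abbrev UPlus (d : Matrix I I ℤ) (q : K) : Type _ := RingQuot (RelPlus d q)

/-- The quadratic algebra `Ũ_q^-(Lg)`. -/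
abbrev UMinus (d : Matrix I I ℤ) (q : K) : Type _ := RingQuot (RelMinus d q)

/-- The generator `e_{i,k}` of `Ũ_q^+(Lg)`. -/
noncomputable def e (d : Matrix I I ℤ) (q : K) (i : I) (k : ℤ) : UPlus d q :=
  RingQuot.mkAlgHom K (RelPlus d q) (gen K i k)

/-- The generator `f_{i,k}` of `Ũ_q^-(Lg)`. -/
noncomputable def f (d : Matrix I I ℤ) (q : K) (i : I) (k : ℤ) : UMinus d q :=
  RingQuot.mkAlgHom K (RelMinus d q) (gen K i k)

end QuadraticAlgebras

section RationalFunctions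

/-- The field `K(z_s : s ∈ σ)` of rational functions. -/
abbrev RatFun (K : Type*) [Field K] (σ : Type*) : Type _ := FractionRing (MvPolynomial σ K)

variable (K : Type*) [Field K] {σ τ : Type*}

/-- The variable `z_s`, as a rational function. -/
noncomputable def z (s : σ) : RatFun K σ :=
  algebraMap (MvPolynomial σ K) (RatFun K σ) (MvPolynomial.X s)

/-- The ring of Laurent polynomials `K[z_s^{±1} : s ∈ σ]`, inside the rational functions. -/
noncomputable def laurent (σ : Type*) : Subalgebra K (RatFun K σ) :=
  Algebra.adjoin K (Set.range (fun s : σ => z K s) ∪ Set.range (fun s : σ => (z K s)⁻¹))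

/-- Renaming of variables: the isomorphism `K(z_s : s ∈ σ) ≃ K(z_t : t ∈ τ)` with
`z_s ↦ z_{β s}`, for a bijection `β : σ ≃ τ`. -/
noncomputable def relabel (β : σ ≃ τ) : RatFun K σ ≃ₐ[K] RatFun K τ :=
  IsFractionRing.algEquivOfAlgEquiv (MvPolynomial.renameEquiv K β)

end RationalFunctions

section BigShuffle

variable (K : Type*) [Field K] {I : Type*}

/-- Index set of the variables `z_{ia}` with `i ∈ I` and `1 ≤ a ≤ n_i` (here `a` is counted
from `0`). -/
abbrev Vars (n : I → ℕ) : Type _ := Σ i : I, Fin (n i)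

/-- Laurent polynomials in the `z_{ia}` that are symmetric in `z_{i1}, …, z_{i n_i}` for each
`i ∈ I` separately. -/
noncomputable def symLaurent (n : I → ℕ) : Submodule K (RatFun K (Vars n)) where
  carrier := {r | r ∈ laurent K (Vars n) ∧
    ∀ π : ∀ i, Equiv.Perm (Fin (n i)), relabel K (Equiv.sigmaCongrRight π) r = r}
  add_mem' := fun {x y} hx hy =>
    ⟨add_mem hx.1 hy.1, fun π => by rw [map_add, hx.2 π, hy.2 π]⟩
  zero_mem' := ⟨zero_mem _, fun _ => map_zero _⟩
  smul_mem' := fun c x hx =>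
    ⟨Subalgebra.smul_mem _ hx.1 c, fun π => by rw [map_smul, hx.2 π]⟩

variable [Fintype I] [LinearOrder I]

/-- The product `∏_{i < j} ∏_{a ≤ n_i, b ≤ n_j} (z_{ia} - z_{jb})`. -/
noncomputable def denom (n : I → ℕ) : RatFun K (Vars n) :=
  ∏ i : I, ∏ j ∈ Finset.univ.filter (fun j : I => i < j),
    ∏ a : Fin (n i), ∏ b : Fin (n j), (z K (⟨i, a⟩ : Vars n) - z K (⟨j, b⟩ : Vars n))

/-- The component of degree `n` of the big shuffle algebra: all `r / ∏_{i < j} (z_{ia} - z_{jb})`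
with `r` a symmetric Laurent polynomial. -/
noncomputable def VComp (n : I → ℕ) : Submodule K (RatFun K (Vars n)) :=
  (symLaurent K n).map (LinearMap.mulRight K (denom K n)⁻¹)

/-- The vector space `⨁_n V_n` underlying both `V^+` and `V^-` (the component of index `n` has
degree `n` in `V^+` and `-n` in `V^-`). -/
abbrev V (K : Type*) [Field K] (I : Type*) [Fintype I] [LinearOrder I] : Type _ :=
  DirectSum (I → ℕ) (fun n => VComp K n)

/-- A rational function `R ∈ V_n`, as a homogeneous element of `V^±`. -/
noncomputable def homog (n : I → ℕ) (R : VComp K n) : V K I :=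
  DirectSum.of (fun n : I → ℕ => VComp K n) n R

end BigShuffle

section Expansion

variable (K : Type*) [Field K] {m : ℕ}

/-- Substitution of `z_a` by the monomial with exponent `ε` at `a`, with values in the Hahn series
in the lexicographically ordered group `ℤ^m`. -/
noncomputable def expandPoly (m : ℕ) (ε : ℤˣ) :
    MvPolynomial (Fin m) K →ₐ[K] HahnSeries (Lex (Fin m → ℤ)) K :=
  MvPolynomial.aeval (fun a => HahnSeries.single (toLex (Pi.single a (ε : ℤ))) (1 : K))

theorem expandPoly_monomial (ε : ℤˣ) (v : Fin m →₀ ℕ) (c : K) :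
    expandPoly K m ε (MvPolynomial.monomial v c) =
      HahnSeries.single (toLex (fun a => (ε : ℤ) * (v a : ℤ))) c := by
  have hpow : ∀ (s : Finset (Fin m)),
      ∏ a ∈ s, (HahnSeries.single (toLex (Pi.single a (ε : ℤ))) (1 : K) :
        HahnSeries (Lex (Fin m → ℤ)) K) ^ v a =
      HahnSeries.single (∑ a ∈ s, v a • (toLex (Pi.single a (ε : ℤ)) : Lex (Fin m → ℤ))) 1 := by
    intro s
    induction s using Finset.induction_on with
    | empty => simp
    | insert a s ha ih =>
      rw [Finset.prod_insert ha, Finset.sum_insert ha, ih, HahnSeries.single_pow,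
        HahnSeries.single_mul_single, one_pow, mul_one]
  have hsum : ∑ a : Fin m, v a • (toLex (Pi.single a (ε : ℤ)) : Lex (Fin m → ℤ)) =
      toLex (fun a => (ε : ℤ) * (v a : ℤ)) := by
    have h : ∑ a : Fin m, v a • (Pi.single a (ε : ℤ) : Fin m → ℤ) =
        fun a => (ε : ℤ) * (v a : ℤ) := by
      funext b
      simp [Finset.sum_apply, Pi.single_apply, mul_comm]
    exact h
  rw [expandPoly, MvPolynomial.aeval_monomial, Finsupp.prod_fintype _ _ (fun _ => pow_zero _),
    hpow, hsum, HahnSeries.algebraMap_apply, HahnSeries.C_apply, HahnSeries.single_mul_single,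
    zero_add, mul_one, Algebra.algebraMap_self_apply]

theorem expandPoly_injective (ε : ℤˣ) : Function.Injective (expandPoly K m ε) := by
  have hinj : Function.Injective
      (fun v : Fin m →₀ ℕ => (toLex (fun a => (ε : ℤ) * (v a : ℤ)) : Lex (Fin m → ℤ))) := by
    intro v w h
    ext a
    have h1 := congrFun (toLex.injective h) a
    simpa using h1
  rw [injective_iff_map_eq_zero]
  intro p hp
  ext v
  have h := congrArg
    (fun x : HahnSeries (Lex (Fin m → ℤ)) K => x.coeff (toLex (fun a => (ε : ℤ) * (v a : ℤ)))) hp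
  rw [p.as_sum, map_sum] at h
  simp only [expandPoly_monomial, HahnSeries.coeff_sum, HahnSeries.coeff_zero] at h
  rw [MvPolynomial.coeff_zero, ← h, Finset.sum_eq_single v]
  · simp
  · intro w _ hw
    exact HahnSeries.coeff_single_of_ne (fun h' => hw (hinj h').symm)
  · intro hv
    simp [MvPolynomial.notMem_support_iff.mp hv]

/-- The expansion of rational functions in `z_1, …, z_m` as iterated Laurent series, a field
embedding into the Hahn series in the lexicographically ordered group `ℤ^m`. The element
`v ∈ ℤ^m` is the exponent of the monomial `∏_a z_a^{ε v_a}`.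

For `ε = -1` the ratios `z_b / z_a` with `a < b` have positive exponent: this is the expansion
in powers of `z_2/z_1, …, z_m/z_{m-1}`, i.e. in the region `|z_1| ≫ … ≫ |z_m|`.

For `ε = 1` the ratios `z_a / z_b` with `a < b` have positive exponent: this is the expansion
in powers of `z_1/z_2, …, z_{m-1}/z_m`, i.e. in the region `|z_1| ≪ … ≪ |z_m|`. -/
noncomputable def expand (m : ℕ) (ε : ℤˣ) :
    RatFun K (Fin m) →+* HahnSeries (Lex (Fin m → ℤ)) K :=
  IsFractionRing.lift (g := (expandPoly K m ε).toRingHom) (expandPoly_injective K ε)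

/-- `∫_{|z_1| ≫ … ≫ |z_m|} F ∏ Dz_a`, the constant term of the expansion of `F`. -/
noncomputable def integralDesc (F : RatFun K (Fin m)) : K := (expand K m (-1) F).coeff 0

/-- `∫_{|z_1| ≪ … ≪ |z_m|} F ∏ Dz_a`, the constant term of the expansion of `F`. -/
noncomputable def integralAsc (F : RatFun K (Fin m)) : K := (expand K m 1 F).coeff 0

end Expansion

section Pairings

variable {K : Type*} [Field K] {I : Type*}

/-- `ζ_ij(x) = (x - q^{-d_ij}) / (x - 1)`, at a rational function `x`. -/
noncomputable def zeta (d : Matrix I I ℤ) (q : K) (i j : I) {m : ℕ} (x : RatFun K (Fin m)) :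
    RatFun K (Fin m) :=
  (x - algebraMap K (RatFun K (Fin m)) (q ^ (-d i j))) / (x - 1)

/-- The integrand
`z_1^{k_1} … z_m^{k_m} R(z_1, …, z_m) / ∏_{a < b} ζ_{i_b i_a}(z_b / z_a)`. -/
noncomputable def integrandPlus (d : Matrix I I ℤ) (q : K) {m : ℕ} (ι : Fin m → I)
    (k : Fin m → ℤ) (R : RatFun K (Fin m)) : RatFun K (Fin m) :=
  (∏ a : Fin m, z K a ^ k a) * R /
    ∏ a : Fin m, ∏ b ∈ Finset.univ.filter (fun b : Fin m => a < b),
      zeta d q (ι b) (ι a) (z K b / z K a)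

/-- The integrand
`z_1^{-k_1} … z_m^{-k_m} R(z_1, …, z_m) / ∏_{a < b} ζ_{i_a i_b}(z_a / z_b)`. -/
noncomputable def integrandMinus (d : Matrix I I ℤ) (q : K) {m : ℕ} (ι : Fin m → I)
    (k : Fin m → ℤ) (R : RatFun K (Fin m)) : RatFun K (Fin m) :=
  (∏ a : Fin m, z K a ^ (-k a)) * R /
    ∏ a : Fin m, ∏ b ∈ Finset.univ.filter (fun b : Fin m => a < b),
      zeta d q (ι a) (ι b) (z K a / z K b)

variable [Fintype I] [LinearOrder I]

/-- `B` is the pairing `Ũ_q^+(Lg) ⊗ V^- → K`: its value on `e_{i_1,k_1} … e_{i_m,k_m}` and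
`R ∈ V_{-n}` is the constant term formula when `n = ς^{i_1} + … + ς^{i_m}`, and `0` otherwise.
A bijection `β` with `(β a).1 = ι a` says into which of the variables `z_{i_a •_a}` of `R` the
variable `z_a` is plugged; the formula is required for every such choice. -/
def IsPairingUV (d : Matrix I I ℤ) (q : K) (B : UPlus d q →ₗ[K] V K I →ₗ[K] K) : Prop :=
  ∀ (m : ℕ) (ι : Fin m → I) (k : Fin m → ℤ) (n : I → ℕ) (R : VComp K n),
    (∀ β : Fin m ≃ Vars n, (∀ a, (β a).1 = ι a) →
      B (List.ofFn fun a => e d q (ι a) (k a)).prod (homog K n R) =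
        integralDesc K (integrandPlus d q ι k (relabel K β.symm (R : RatFun K (Vars n))))) ∧
    (n ≠ ∑ a : Fin m, Pi.single (ι a) 1 →
      B (List.ofFn fun a => e d q (ι a) (k a)).prod (homog K n R) = 0)

/-- `B` is the pairing `V^+ ⊗ Ũ_q^-(Lg) → K`: its value on `R ∈ V_n` and
`f_{i_1,-k_1} … f_{i_m,-k_m}` is the constant term formula when
`n = ς^{i_1} + … + ς^{i_m}`, and `0` otherwise. -/
def IsPairingVU (d : Matrix I I ℤ) (q : K) (B : V K I →ₗ[K] UMinus d q →ₗ[K] K) : Prop :=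
  ∀ (m : ℕ) (ι : Fin m → I) (k : Fin m → ℤ) (n : I → ℕ) (R : VComp K n),
    (∀ β : Fin m ≃ Vars n, (∀ a, (β a).1 = ι a) →
      B (homog K n R) (List.ofFn fun a => f d q (ι a) (-k a)).prod =
        integralAsc K (integrandMinus d q ι k (relabel K β.symm (R : RatFun K (Vars n))))) ∧
    (n ≠ ∑ a : Fin m, Pi.single (ι a) 1 →
      B (homog K n R) (List.ofFn fun a => f d q (ι a) (-k a)).prod = 0)

end Pairings

end QuantumLoop

/-! Put `t_a = z_a^ε`, with `ε = -1` for the first pairing and `ε = 1` for the second. Both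
integrals then become the coefficient of `t^k` in the expansion of `R` times the kernel `∏_{a<b}
ζ_{i_a i_b}(t_a / t_b)⁻¹`, expanded in powers of `t_a / t_b` for `a < b`. Moreover `e_{i,k}` and
`f_{i,-k}` satisfy the same quadratic relations. One argument, for either `ε` and any algebra
presented by these relations, therefore covers both pairings.

Existence: a relation between adjacent letters at `c`, `c'` multiplies the integrand by a monomial
times `t_c - q^{-d} t_{c'}`, which removes the pole of the kernel factor of `(c, c')`. The numerator
`t_c - t_{c'}` left over from this factor removes the only possible pole of `R` along `t_c =
t_{c'}`. What remains has the same expansion for either order of `t_c` and `t_{c'}`, and this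
equates the two sides of the relation (`pairCoeff_swap`). Uniqueness holds because words span.

Non-degeneracy in `V`: as `k` varies, the pairings with words of one fixed colouring read off all
coefficients of the expansion of `R` times the kernel. The kernel is nonzero and Hahn series form a
field, so `R = 0`.

Non-degeneracy in the algebra: straightening shows that the words for which `(k_a + a, i_a)`
increases strictly in the lexicographic order span (`prod_mem_span_sorted`). To a sorted word `w₀`
one attaches the symmetrized monomial with exponents `leadExp`, divided by the product of
differences. By the leading term of the kernel, it pairs with `w` to a nonzero value only if some
colour-matching rearrangement of the leading exponents of `w₀` is lexicographically at most those of
`w`. This forces `w₀ ≤ w` in the order of shifted letters (`shiftedLetter_le`). The pairing is thus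
triangular on sorted words, and each diagonal entry is a positive integer times a nonzero leading
coefficient, hence nonzero in characteristic `0`. -/

namespace QuantumLoop

/-! ### Sorted words and a measure for straightening -/

section SortedWords

variable {I : Type*}

/-- The condition on consecutive letters `(i, k)`, `(j, l)` of a sorted word. -/
def LetterLE [LinearOrder I] (x y : I × ℤ) : Prop := x.2 ≤ y.2 ∨ (x.2 = y.2 + 1 ∧ x.1 < y.1)

/-- The sum of the squares of the differences between exponents and positions, where the first
position is `s`. -/
def energy : ℤ → List (I × ℤ) → ℕ
  | _, [] => 0
  | s, x :: l => (x.2 - s).natAbs ^ 2 + energy (s + 1) l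

theorem energy_append_lt (u : List (I × ℤ)) {v w : List (I × ℤ)}
    (h : ∀ s, energy s v < energy s w) (s : ℤ) : energy s (u ++ v) < energy s (u ++ w) := by
  induction u generalizing s with
  | nil => exact h s
  | cons x u ih => simpa [energy] using ih (s + 1)

theorem energy_append_eq (u : List (I × ℤ)) {v w : List (I × ℤ)}
    (h : ∀ s, energy s v = energy s w) (s : ℤ) : energy s (u ++ v) = energy s (u ++ w) := by
  induction u generalizing s with
  | nil => exact h s
  | cons x u ih => simpa [energy] using ih (s + 1)

theorem energy_pair_lt {i j i' j' : I} {a b a' b' : ℤ} (v : List (I × ℤ))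
    (h : ∀ s : ℤ, (a' - s) ^ 2 + (b' - (s + 1)) ^ 2 < (a - s) ^ 2 + (b - (s + 1)) ^ 2) (s : ℤ) :
    energy s ((i', a') :: (j', b') :: v) < energy s ((i, a) :: (j, b) :: v) := by
  have := h s
  simp only [energy]
  zify
  simp only [sq_abs]
  linarith

variable [Fintype I] [LinearOrder I]

/-- The sum of the ranks of the colours, with weights that decrease from left to right. -/
def colourWeight : List (I × ℤ) → ℕ
  | [] => 0
  | x :: l => (l.length + 1) * (Finset.univ.filter (· < x.1)).card + colourWeight l

theorem colourWeight_append_lt (u : List (I × ℤ)) {v w : List (I × ℤ)}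
    (hl : v.length = w.length) (h : colourWeight v < colourWeight w) :
    colourWeight (u ++ v) < colourWeight (u ++ w) := by
  induction u with
  | nil => exact h
  | cons x u ih => simpa [colourWeight, hl] using ih

/-- The order on words that decreases under the straightening of quadratic relations. -/
def wordMeasure (w : List (I × ℤ)) : ℕ ×ₗ ℕ := toLex (energy 0 w, colourWeight w)

theorem wordMeasure_lt_of_energy (u : List (I × ℤ)) {v w : List (I × ℤ)}
    (h : ∀ s, energy s v < energy s w) : wordMeasure (u ++ v) < wordMeasure (u ++ w) :=
  Prod.Lex.toLex_lt_toLex.2 (Or.inl (energy_append_lt u h 0))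

/-- The exponents stay in place, so the energy is unchanged, while the larger colour moves to the
right, where its weight is smaller. -/
theorem wordMeasure_lt_of_swap (u v : List (I × ℤ)) {i j : I} (hij : j < i) (a : ℤ) :
    wordMeasure (u ++ (j, a + 1) :: (i, a) :: v) < wordMeasure (u ++ (i, a + 1) :: (j, a) :: v) := by
  refine Prod.Lex.toLex_lt_toLex.2 (Or.inr ⟨energy_append_eq u
    (v := (j, a + 1) :: (i, a) :: v) (w := (i, a + 1) :: (j, a) :: v) (fun _ => rfl) 0,
    colourWeight_append_lt u (by simp) ?_⟩)
  have h : (Finset.univ.filter (· < j)).card < (Finset.univ.filter (· < i)).card :=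
    Finset.card_lt_card ⟨fun x hx => by
      simp only [Finset.mem_filter, Finset.mem_univ, true_and] at hx ⊢
      exact hx.trans hij, fun h => by simpa using h (by simpa using hij : j ∈ _)⟩
  simp only [colourWeight, List.length_cons]
  nlinarith

end SortedWords

/-! ### Algebras presented by the quadratic relations -/

section Presentation

variable {K : Type*} [Field K] {I : Type*}

/-- The elements `g (i, k)` of an algebra satisfy the relations of `e_{i,k}`. -/
def QuadRel (d : Matrix I I ℤ) (q : K) {A : Type*} [Ring A] [Algebra K A] (g : I × ℤ → A) : Prop :=
  ∀ (i j : I) (k l : ℤ),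
    g (i, k + 1) * g (j, l) - q ^ d i j • (g (i, k) * g (j, l + 1)) =
      q ^ d i j • (g (j, l) * g (i, k + 1)) - g (j, l + 1) * g (i, k)

/-- A function on words that satisfies the relations of `e_{i,k}` in all contexts. -/
def QuadRelFun (d : Matrix I I ℤ) (q : K) {P : Type*} [AddCommGroup P] [Module K P]
    (Φ : List (I × ℤ) → P) : Prop :=
  ∀ (u v : List (I × ℤ)) (i j : I) (k l : ℤ),
    Φ (u ++ (i, k + 1) :: (j, l) :: v) - q ^ d i j • Φ (u ++ (i, k) :: (j, l + 1) :: v) =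
      q ^ d i j • Φ (u ++ (j, l) :: (i, k + 1) :: v) - Φ (u ++ (j, l + 1) :: (i, k) :: v)

/-- The algebra `A` is presented by the generators `g (i, k)` and the quadratic relations. -/
structure IsQuadPresentation (d : Matrix I I ℤ) (q : K) {A : Type*} [Ring A] [Algebra K A]
    (g : I × ℤ → A) : Prop where
  rel : QuadRel d q g
  span : ∀ a, a ∈ Submodule.span K (Set.range fun w : List (I × ℤ) => (w.map g).prod)
  lift : ∀ {Φ : List (I × ℤ) → K}, QuadRelFun d q Φ →
    ∃ ψ : A →ₗ[K] K, ∀ w, ψ (w.map g).prod = Φ w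

/-- At an unsorted pair the exponents are `(x + 1, y)` with `y ≤ x`, and the relation produces `(x,
y + 1)`, `(y, x + 1)` and `(y + 1, x)`. Because exponents are compared with positions, the energy
drops by `2(x - y) + 2` for the first two and by `4(x - y)` for the third. When `x = y` the third
word only exchanges the two colours, and the colour weight decides. -/
theorem prod_mem_span_sorted [CharZero K] [Fintype I] [LinearOrder I] {d : Matrix I I ℤ} {q : K}
    {A : Type*} [Ring A] [Algebra K A] {g : I × ℤ → A} (hg : QuadRel d q g) (w : List (I × ℤ)) :
    (w.map g).prod ∈
      Submodule.span K ((fun w : List (I × ℤ) => (w.map g).prod) '' {w | w.IsChain LetterLE}) := by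
  set S := Submodule.span K
    ((fun w : List (I × ℤ) => (w.map g).prod) '' {w | w.IsChain LetterLE}) with hS
  induction hn : wordMeasure w using WellFoundedLT.induction generalizing w with
  | ind n ih =>
    subst hn
    replace ih : ∀ w', wordMeasure w' < wordMeasure w → (w'.map g).prod ∈ S :=
      fun w' h => ih _ h w' rfl
    by_cases hw : w.IsChain LetterLE
    · exact Submodule.subset_span ⟨w, hw, rfl⟩
    rw [List.isChain_iff_forall_rel_of_append_cons_cons] at hw
    push Not at hw
    obtain ⟨⟨i, k⟩, ⟨j, y⟩, u, v, rfl, hxy⟩ := hw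
    obtain ⟨x, rfl⟩ : ∃ x, k = x + 1 := ⟨k - 1, by ring⟩
    simp only [LetterLE, not_or, not_le, not_and, not_lt] at hxy
    obtain ⟨hlt, himp⟩ := hxy
    have hyx : y ≤ x := by omega
    have key : ((u ++ (i, x + 1) :: (j, y) :: v).map g).prod =
        q ^ d i j • ((u ++ (i, x) :: (j, y + 1) :: v).map g).prod +
        q ^ d i j • ((u ++ (j, y) :: (i, x + 1) :: v).map g).prod -
        ((u ++ (j, y + 1) :: (i, x) :: v).map g).prod := by
      have h := congrArg (fun a => (u.map g).prod * a * (v.map g).prod)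
        (sub_eq_iff_eq_add.1 (hg i j x y))
      simp only [mul_add, add_mul, mul_sub, sub_mul, mul_smul_comm, smul_mul_assoc] at h
      simp only [List.map_append, List.map_cons, List.prod_append, List.prod_cons, ← mul_assoc]
        at h ⊢
      rw [h]
      abel
    have h1 : ((u ++ (i, x) :: (j, y + 1) :: v).map g).prod ∈ S :=
      ih _ (wordMeasure_lt_of_energy u (energy_pair_lt v fun s => by nlinarith))
    have h2 : ((u ++ (j, y) :: (i, x + 1) :: v).map g).prod ∈ S :=
      ih _ (wordMeasure_lt_of_energy u (energy_pair_lt v fun s => by nlinarith))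
    have h12 := S.add_mem (S.smul_mem (q ^ d i j) h1) (S.smul_mem (q ^ d i j) h2)
    rcases hyx.lt_or_eq with hyx | rfl
    · rw [key]
      exact S.sub_mem h12
        (ih _ (wordMeasure_lt_of_energy u (energy_pair_lt v fun s => by nlinarith)))
    · rcases (himp rfl).lt_or_eq with hij | rfl
      · rw [key]
        exact S.sub_mem h12 (ih _ (wordMeasure_lt_of_swap u v hij y))
      -- For equal colours and `x = y` the third word is the given one, so the relation expresses
      -- twice this word through smaller ones.
      · rw [eq_sub_iff_add_eq, ← two_smul K] at key
        rw [← key] at h12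
        exact (S.smul_mem_iff two_ne_zero).1 h12

theorem IsQuadPresentation.mem_span_sorted [CharZero K] [Fintype I] [LinearOrder I]
    {d : Matrix I I ℤ} {q : K} {A : Type*} [Ring A] [Algebra K A] {g : I × ℤ → A}
    (hg : IsQuadPresentation d q g) (a : A) :
    a ∈ Submodule.span K
      ((fun w : List (I × ℤ) => (w.map g).prod) '' {w | w.IsChain LetterLE}) := by
  refine Submodule.span_le.2 ?_ (hg.span a)
  rintro _ ⟨w, rfl⟩
  exact prod_mem_span_sorted hg.rel w

/-- A linear map on an algebra that respects the given relations in all contexts is constant on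
the fibres of the quotient by these relations. -/
theorem map_eq_of_mkAlgHom_eq {F P : Type*} [Ring F] [Algebra K F] [AddCommGroup P] [Module K P]
    {r : F → F → Prop} (φ : F →ₗ[K] P)
    (h : ∀ a b, r a b → ∀ u v, φ (u * a * v) = φ (u * b * v)) {x y : F}
    (hxy : RingQuot.mkAlgHom K r x = RingQuot.mkAlgHom K r y) : φ x = φ y := by
  -- Having equal values of `φ` in all two-sided contexts is a ring congruence that contains `r`, so
  -- the quotient by `r` maps onto the quotient by `c`. The empty context then recovers `φ` itself.
  let c : RingCon F :=
    { r := fun x y => ∀ u v, φ (u * x * v) = φ (u * y * v)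
      iseqv := ⟨fun _ _ _ => rfl, fun h u v => (h u v).symm, fun h h' u v => (h u v).trans (h' u v)⟩
      mul' := fun {w x y z} h h' u v => by
        have h1 := h u (y * v)
        have h2 := h' (u * x) v
        simp only [mul_assoc] at h1 h2 ⊢
        exact h1.trans h2
      add' := fun {w x y z} h h' u v => by
        simp only [mul_add, add_mul, map_add, h u v, h' u v] }
  have hc : ∀ ⦃a b⦄, r a b → c.mk' a = c.mk' b := fun a b hab => (RingCon.eq c).2 (h a b hab)
  have hx : RingQuot.mkRingHom r x = RingQuot.mkRingHom r y := by
    rw [← RingQuot.mkAlgHom_coe K r]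
    exact hxy
  have := congrArg (RingQuot.lift ⟨c.mk', hc⟩) hx
  rw [RingQuot.lift_mkRingHom_apply, RingQuot.lift_mkRingHom_apply] at this
  simpa using (RingCon.eq c).1 this 1 1

theorem freeAlgebra_mem_span (a : FreeAlgebra K (I × ℤ)) :
    a ∈ Submodule.span K
      (Set.range fun w : List (I × ℤ) => (w.map (FreeAlgebra.ι K)).prod) := by
  set S := Submodule.span K
      (Set.range fun w : List (I × ℤ) => (w.map (FreeAlgebra.ι K)).prod)
  have hS : ∀ w : List (I × ℤ), (w.map (FreeAlgebra.ι K)).prod ∈ S := fun w =>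
    Submodule.subset_span ⟨w, rfl⟩
  induction a with
  | grade0 r =>
    rw [Algebra.algebraMap_eq_smul_one]
    exact S.smul_mem r (hS [])
  | grade1 x => simpa using hS [x]
  | mul a b ha hb =>
    induction ha using Submodule.span_induction with
    | mem x hx =>
      obtain ⟨w, rfl⟩ := hx
      induction hb using Submodule.span_induction with
      | mem y hy =>
        obtain ⟨w', rfl⟩ := hy
        simpa using hS (w ++ w')
      | zero => simp
      | add y y' _ _ h h' => rw [mul_add]; exact S.add_mem h h'
      | smul c y _ h => rw [mul_smul_comm]; exact S.smul_mem c h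
    | zero => simp
    | add x x' _ _ h h' => rw [add_mul]; exact S.add_mem h h'
    | smul c x _ h => rw [smul_mul_assoc]; exact S.smul_mem c h
  | add a b ha hb => exact S.add_mem ha hb

theorem exists_linearMap_freeAlgebra (Φ : List (I × ℤ) → K) :
    ∃ φ : FreeAlgebra K (I × ℤ) →ₗ[K] K,
      ∀ w : List (I × ℤ), φ (w.map (FreeAlgebra.ι K)).prod = Φ w := by
  let E := FreeAlgebra.equivMonoidAlgebraFreeMonoid (R := K) (X := I × ℤ)
  have hE : ∀ w : List (I × ℤ), E (w.map (FreeAlgebra.ι K)).prod =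
      MonoidAlgebra.single (FreeMonoid.ofList w) 1 := by
    intro w
    induction w with
    | nil => simp [MonoidAlgebra.one_def]
    | cons x w ih =>
      rw [List.map_cons, List.prod_cons, map_mul, ih, FreeMonoid.ofList_cons]
      simp [E, FreeAlgebra.equivMonoidAlgebraFreeMonoid, MonoidAlgebra.single_mul_single]
  let b := FreeAlgebra.basisFreeMonoid K (I × ℤ)
  refine ⟨b.constr K (fun w => Φ (FreeMonoid.toList w)), fun w => ?_⟩
  have hb : b (FreeMonoid.ofList w) = (w.map (FreeAlgebra.ι K)).prod := by
    apply E.injective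
    rw [hE]
    simp [b, FreeAlgebra.basisFreeMonoid, E]
  rw [← hb, b.constr_basis]
  rfl

/-- A quotient of the free algebra by relations that amount to the quadratic relations of the
`g (i, k)` is presented by these elements. -/
theorem isQuadPresentation_mkAlgHom {d : Matrix I I ℤ} {q : K}
    {r : FreeAlgebra K (I × ℤ) → FreeAlgebra K (I × ℤ) → Prop} (σ : I × ℤ ≃ I × ℤ)
    (hrel : QuadRel d q fun x => RingQuot.mkAlgHom K r (FreeAlgebra.ι K (σ x)))
    (hlift : ∀ (φ : FreeAlgebra K (I × ℤ) →ₗ[K] K) (a b), r a b →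
      QuadRelFun d q (fun w => φ ((w.map fun x => FreeAlgebra.ι K (σ x)).prod)) →
      ∀ u v : List (I × ℤ), φ ((u.map fun x => FreeAlgebra.ι K (σ x)).prod * a *
          (v.map fun x => FreeAlgebra.ι K (σ x)).prod) =
        φ ((u.map fun x => FreeAlgebra.ι K (σ x)).prod * b *
          (v.map fun x => FreeAlgebra.ι K (σ x)).prod)) :
    IsQuadPresentation d q fun x => RingQuot.mkAlgHom K r (FreeAlgebra.ι K (σ x)) := by
  have hspan : ∀ a : FreeAlgebra K (I × ℤ), a ∈ Submodule.span K
      (Set.range fun w : List (I × ℤ) => (w.map fun x => FreeAlgebra.ι K (σ x)).prod) := by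
    intro a
    refine Submodule.span_mono ?_ (freeAlgebra_mem_span a)
    rintro _ ⟨w, rfl⟩
    exact ⟨w.map σ.symm, by simp [Function.comp_def]⟩
  refine ⟨hrel, fun a => ?_, fun {Φ} hΦ => ?_⟩
  · obtain ⟨b, rfl⟩ := RingQuot.mkAlgHom_surjective K r a
    have h := Submodule.mem_map_of_mem (f := (RingQuot.mkAlgHom K r).toLinearMap) (hspan b)
    rw [Submodule.map_span, ← Set.range_comp] at h
    have hcomp : ((RingQuot.mkAlgHom K r).toLinearMap ∘ fun w : List (I × ℤ) =>
        (w.map fun x => FreeAlgebra.ι K (σ x)).prod) = fun w : List (I × ℤ) =>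
        (w.map fun x => RingQuot.mkAlgHom K r (FreeAlgebra.ι K (σ x))).prod := by
      funext w
      simp [map_list_prod, Function.comp_def]
    rwa [hcomp] at h
  · obtain ⟨φ, hφ⟩ := exists_linearMap_freeAlgebra (K := K) (fun w => Φ (w.map σ.symm))
    have hφ' : ∀ w : List (I × ℤ), φ ((w.map fun x => FreeAlgebra.ι K (σ x)).prod) = Φ w := by
      intro w
      have := hφ (w.map σ)
      simpa [Function.comp_def] using this
    have hker : LinearMap.ker (RingQuot.mkAlgHom K r).toLinearMap ≤ LinearMap.ker φ := by
      intro x hx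
      rw [LinearMap.mem_ker] at hx ⊢
      rw [← map_zero φ]
      refine map_eq_of_mkAlgHom_eq (r := r) φ (fun a b hab u v => ?_) (by simpa using hx)
      have h := hlift φ a b hab (by simpa only [hφ'] using hΦ)
      induction hspan u using Submodule.span_induction with
      | mem x hx =>
        obtain ⟨w, rfl⟩ := hx
        induction hspan v using Submodule.span_induction with
        | mem y hy =>
          obtain ⟨w', rfl⟩ := hy
          exact h w w'
        | zero => simp
        | add y y' _ _ h h' => simp only [mul_add, map_add, h, h']
        | smul c y _ h => simp only [mul_smul_comm, map_smul, h]
      | zero => simp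
      | add x x' _ _ h h' => simp only [add_mul, map_add, h, h']
      | smul c x _ h => simp only [smul_mul_assoc, map_smul, h]
    have hsurj : Function.Surjective (RingQuot.mkAlgHom K r).toLinearMap :=
      RingQuot.mkAlgHom_surjective K r
    refine ⟨((LinearMap.ker _).liftQ φ hker).comp
      (LinearMap.quotKerEquivOfSurjective _ hsurj).symm.toLinearMap, fun w => ?_⟩
    rw [← hφ' w]
    have : (w.map fun x => RingQuot.mkAlgHom K r (FreeAlgebra.ι K (σ x))).prod =
        (RingQuot.mkAlgHom K r).toLinearMap (w.map fun x => FreeAlgebra.ι K (σ x)).prod := by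
      simp [map_list_prod, Function.comp_def]
    rw [this, LinearMap.comp_apply, LinearEquiv.coe_coe,
      show (RingQuot.mkAlgHom K r).toLinearMap (w.map fun x => FreeAlgebra.ι K (σ x)).prod =
        LinearMap.quotKerEquivOfSurjective _ hsurj (Submodule.Quotient.mk
          (w.map fun x => FreeAlgebra.ι K (σ x)).prod) from rfl,
      LinearEquiv.symm_apply_apply, Submodule.liftQ_apply]

theorem isQuadPresentation_e (d : Matrix I I ℤ) (q : K) :
    IsQuadPresentation d q fun x : I × ℤ => e d q x.1 x.2 := by
  refine isQuadPresentation_mkAlgHom (Equiv.refl _) (fun i j k l => ?_) ?_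
  · simpa [gen] using RingQuot.mkAlgHom_rel K (RelPlus.quad (d := d) (q := q) i j k l)
  · rintro φ _ _ ⟨i, j, k, l⟩ hφ u v
    simpa [gen, mul_sub, sub_mul, mul_assoc] using hφ u v i j k l

/-- The relation of the `f`'s at `-(k + 1)`, `-(l + 1)`, multiplied by `-q ^ d i j`, is the relation
of the `e`'s at `k`, `l`. This is why the exponents are negated. -/
theorem isQuadPresentation_f (d : Matrix I I ℤ) {q : K} (hq : q ≠ 0) :
    IsQuadPresentation d q fun x : I × ℤ => f d q x.1 (-x.2) := by
  refine isQuadPresentation_mkAlgHom ((Equiv.refl I).prodCongr (Equiv.neg ℤ))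
    (fun i j k l => ?_) ?_
  · have h := RingQuot.mkAlgHom_rel K (RelMinus.quad (d := d) (q := q) i j (-(k + 1)) (-(l + 1)))
    have h1 : -(k + 1) + 1 = -k := by ring
    have h2 : -(l + 1) + 1 = -l := by ring
    have hc : q ^ d i j * q ^ (-d i j) = 1 := by rw [← zpow_add₀ hq]; simp
    replace h := congrArg (fun a => q ^ d i j • a) h
    simp only [gen, h1, h2, map_sub, map_mul, map_smul, smul_sub, smul_smul, hc, one_smul] at h
    simp only [Equiv.prodCongr_apply, Prod.map_apply, Equiv.refl_apply, Equiv.neg_apply]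
    rw [← neg_sub, h, neg_sub]
  · rintro φ _ _ ⟨i, j, k, l⟩ hφ u v
    have h := hφ u v i j (-(k + 1)) (-(l + 1))
    have h1 : -(k + 1) + 1 = -k := by ring
    have h2 : -(l + 1) + 1 = -l := by ring
    have hc : q ^ (-d i j) * q ^ d i j = 1 := by rw [← zpow_add₀ hq]; simp
    replace h := congrArg (fun a => - (q ^ (-d i j) * a)) h
    simp only [h1, h2, smul_eq_mul, mul_sub, ← mul_assoc, hc, one_mul] at h
    simp only [Equiv.prodCongr_apply, Prod.map_apply, Equiv.refl_apply, Equiv.neg_apply,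
      List.map_append, List.map_cons, List.prod_append, List.prod_cons, neg_neg] at h
    simp only [gen, mul_sub, sub_mul, mul_smul_comm, smul_mul_assoc, map_sub, map_smul,
      smul_eq_mul, mul_assoc, Equiv.prodCongr_apply, Equiv.neg_apply] at h ⊢
    linear_combination h

end Presentation

/-! ### Lexicographic comparison of sorted words through their leading exponents -/

section LexCombinatorics

variable {m : ℕ} {I : Type*} [LinearOrder I]

/-- The number of earlier letters of a different colour. -/
def diffBefore (ι : Fin m → I) (b : Fin m) : ℕ :=
  (Finset.univ.filter (fun a : Fin m => a < b ∧ ι a ≠ ι b)).card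

/-- The number of earlier letters of the same colour. -/
def sameBefore (ι : Fin m → I) (b : Fin m) : ℕ :=
  (Finset.univ.filter (fun a : Fin m => a < b ∧ ι a = ι b)).card

theorem sameBefore_add_diffBefore (ι : Fin m → I) (b : Fin m) :
    sameBefore ι b + diffBefore ι b = b := by
  rw [sameBefore, diffBefore, ← Finset.card_union_of_disjoint]
  · rw [← Finset.filter_or]
    conv_rhs => rw [← Fin.card_Iio b]
    congr 1
    ext a
    simp only [Finset.mem_filter, Finset.mem_univ, true_and, Finset.mem_Iio]
    tauto
  · rw [Finset.disjoint_filter]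
    tauto

/-- The exponents of the leading monomial that is dual to a sorted word. -/
def leadExp (ι : Fin m → I) (k : Fin m → ℤ) (b : Fin m) : ℤ := k b + diffBefore ι b

/-- The letters of a word, with exponents shifted by the position. -/
def shiftedLetter (ι : Fin m → I) (k : Fin m → ℤ) (a : Fin m) : ℤ ×ₗ I :=
  toLex (k a + (a : ℕ), ι a)

theorem shiftedLetter_fst (ι : Fin m → I) (k : Fin m → ℤ) (a : Fin m) :
    k a + (a : ℕ) = leadExp ι k a + sameBefore ι a := by
  have := sameBefore_add_diffBefore ι a
  rw [leadExp]
  omega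

/-- After adding positions, `k_a ≤ k_{a+1}` becomes a strict increase and the exceptional case `k_a
= k_{a+1} + 1` becomes a tie, which the colours break. -/
theorem strictMono_shiftedLetter {ι : Fin m → I} {k : Fin m → ℤ}
    (h : (List.ofFn fun a => (ι a, k a)).IsChain LetterLE) : StrictMono (shiftedLetter ι k) := by
  rw [List.isChain_ofFn] at h
  cases m with
  | zero => exact fun a => a.elim0
  | succ m =>
    rw [Fin.strictMono_iff_lt_succ]
    intro i
    have hi := h i (by omega)
    rw [shiftedLetter, shiftedLetter, Prod.Lex.toLex_lt_toLex]
    have h1 : (⟨(i : ℕ), by omega⟩ : Fin (m + 1)) = i.castSucc := rfl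
    have h2 : (⟨(i : ℕ) + 1, by omega⟩ : Fin (m + 1)) = i.succ := rfl
    simp only [h1, h2, LetterLE] at hi
    simp only [Fin.val_castSucc, Fin.val_succ]
    rcases hi with hi | ⟨hi, hi'⟩
    · left; push_cast; omega
    · right; exact ⟨by push_cast; omega, hi'⟩

/-- Shifted exponents of a given colour are strictly increasing, so that they grow at least as
fast as the number of letters of this colour. -/
theorem card_le_of_strictMono {ι : Fin m → I} {k : Fin m → ℤ}
    (hs : StrictMono (shiftedLetter ι k)) {a b : Fin m} (hab : a ≤ b) :
    ((Finset.univ.filter (fun x : Fin m => a ≤ x ∧ x < b ∧ ι x = ι b)).card : ℤ) ≤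
      (k b + (b : ℕ)) - (k a + (a : ℕ)) := by
  have hmono : ∀ {x y : Fin m}, x ≤ y → k x + (x : ℕ) ≤ k y + (y : ℕ) := by
    intro x y hxy
    have := hs.monotone hxy
    rw [shiftedLetter, shiftedLetter, Prod.Lex.toLex_le_toLex] at this
    rcases this with h | h
    · exact h.le
    · exact h.1.le
  have hlt : ∀ {x y : Fin m}, x < y → ι x = ι y → k x + (x : ℕ) < k y + (y : ℕ) := by
    intro x y hxy hι
    have := hs hxy
    rw [shiftedLetter, shiftedLetter, Prod.Lex.toLex_lt_toLex] at this
    rcases this with h | h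
    · exact h
    · exact absurd h.2 (by simp [hι])
  have hcard : (Finset.univ.filter (fun x : Fin m => a ≤ x ∧ x < b ∧ ι x = ι b)).card ≤
      (Finset.Ico (k a + (a : ℕ)) (k b + (b : ℕ))).card := by
    refine Finset.card_le_card_of_injOn (fun x => k x + (x : ℕ)) ?_ ?_
    · intro x hx
      simp only [Finset.coe_filter, Finset.mem_univ, true_and, Set.mem_ofPred_eq] at hx
      simp only [Finset.coe_Ico, Set.mem_Ico]
      exact ⟨hmono hx.1, hlt hx.2.1 hx.2.2⟩
    · intro x hx y hy hxy
      simp only [Finset.coe_filter, Finset.mem_univ, true_and, Set.mem_ofPred_eq] at hx hy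
      have hι : ι x = ι y := hx.2.2.trans hy.2.2.symm
      rcases lt_trichotomy x y with h | h | h
      · exact absurd hxy (hlt h hι).ne
      · exact h
      · exact absurd hxy (hlt h hι.symm).ne'
  rw [Int.card_Ico] at hcard
  have := hmono hab
  omega

/-- `leadExp` is the shifted exponent minus the number of earlier letters of the same colour.
Between two letters of one colour the shifted exponent grows by at least the number of letters of
this colour passed, so the difference cannot decrease. -/
theorem leadExp_mono {ι : Fin m → I} {k : Fin m → ℤ} (hs : StrictMono (shiftedLetter ι k))
    {a b : Fin m} (hab : a ≤ b) (hι : ι a = ι b) : leadExp ι k a ≤ leadExp ι k b := by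
  have h := card_le_of_strictMono hs hab
  have ha := shiftedLetter_fst ι k a
  have hb := shiftedLetter_fst ι k b
  have hcard : sameBefore ι b ≤ sameBefore ι a +
      (Finset.univ.filter (fun x : Fin m => a ≤ x ∧ x < b ∧ ι x = ι b)).card := by
    rw [sameBefore, sameBefore]
    refine le_trans (Finset.card_le_card ?_) (Finset.card_union_le _ _)
    intro x hx
    simp only [Finset.mem_filter, Finset.mem_univ, true_and, Finset.mem_union] at hx ⊢
    rcases lt_or_ge x a with h | h
    · exact Or.inl ⟨h, hx.2.trans hι.symm⟩
    · exact Or.inr ⟨h, hx⟩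
  omega

/-- Pigeonhole: otherwise all positions of colour `ι a` with value at most `φ₀ (τ a)` lie before
`a`, and `τ` maps this set together with `a` injectively into the set itself. -/
theorem exists_ge_of_agree {ι ι₀ : Fin m → I} {φ₀ : Fin m → ℤ} (τ : Equiv.Perm (Fin m))
    (hτ : ∀ a, ι a = ι₀ (τ a)) (a : Fin m)
    (h : ∀ x < a, ι x = ι₀ x ∧ φ₀ (τ x) = φ₀ x) :
    ∃ b, a ≤ b ∧ ι₀ b = ι a ∧ φ₀ b ≤ φ₀ (τ a) := by
  by_contra hcon
  push Not at hcon
  set Y := Finset.univ.filter (fun x => ι₀ x = ι a ∧ φ₀ x ≤ φ₀ (τ a)) with hY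
  have hYa : ∀ x ∈ Y, x < a := by
    intro x hx
    simp only [hY, Finset.mem_filter, Finset.mem_univ, true_and] at hx
    by_contra hxa
    exact absurd hx.2 (not_le.2 (hcon x (not_lt.1 hxa) hx.1))
  have hsub : insert a Y ⊆ Y.map τ.symm.toEmbedding := by
    intro x hx
    rw [Finset.mem_map_equiv, Equiv.symm_symm]
    rcases Finset.mem_insert.1 hx with rfl | hx
    · simp [hY, hτ]
    · have hxa := h x (hYa x hx)
      simp only [hY, Finset.mem_filter, Finset.mem_univ, true_and] at hx ⊢
      rw [← hτ, hxa.1, hxa.2]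
      exact hx
  have := Finset.card_le_card hsub
  rw [Finset.card_map, Finset.card_insert_of_notMem (fun ha => lt_irrefl a (hYa a ha))] at this
  omega

/-- On a common prefix the two words have the same leading exponents. Pigeonhole and monotonicity
within a colour make each rearranged exponent at least the original one; the first strict excess
would contradict `hle`. -/
theorem leadExp_agree {ι ι₀ : Fin m → I} {k k₀ : Fin m → ℤ}
    (hs₀ : StrictMono (shiftedLetter ι₀ k₀)) (τ : Equiv.Perm (Fin m))
    (hτ : ∀ a, ι a = ι₀ (τ a))
    (hle : toLex (fun a => leadExp ι₀ k₀ (τ a)) ≤ toLex (leadExp ι k)) (a : Fin m)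
    (h : ∀ x < a, shiftedLetter ι k x = shiftedLetter ι₀ k₀ x) :
    ∀ x < a, ι x = ι₀ x ∧ leadExp ι k x = leadExp ι₀ k₀ x ∧
      leadExp ι₀ k₀ (τ x) = leadExp ι₀ k₀ x := by
  have hι : ∀ x < a, ι x = ι₀ x := fun x hx => congrArg (fun p => (ofLex p).2) (h x hx)
  have hk : ∀ x < a, k x = k₀ x := fun x hx => by
    have := congrArg (fun p => (ofLex p).1) (h x hx)
    simpa [shiftedLetter] using this
  have hlead : ∀ x < a, leadExp ι k x = leadExp ι₀ k₀ x := by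
    intro x hx
    rw [leadExp, leadExp, hk x hx, diffBefore, diffBefore]
    congr 3
    ext y
    simp only [Finset.mem_filter, Finset.mem_univ, true_and]
    refine and_congr_right fun hy => ?_
    rw [hι y (hy.trans hx), hι x hx]
  intro x
  induction x using WellFoundedLT.induction with
  | ind x ih =>
    intro hx
    refine ⟨hι x hx, hlead x hx, ?_⟩
    obtain ⟨b, hb, hιb, hφb⟩ := exists_ge_of_agree (φ₀ := leadExp ι₀ k₀) τ hτ x
      (fun y hy => ⟨hι y (hy.trans hx), (ih y hy (hy.trans hx)).2.2⟩)
    have h1 : leadExp ι₀ k₀ x ≤ leadExp ι₀ k₀ (τ x) :=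
      (leadExp_mono hs₀ hb ((hι x hx).symm.trans hιb.symm)).trans hφb
    by_contra hne
    refine absurd hle (not_le.2 ?_)
    refine ⟨x, fun y hy => ?_, ?_⟩
    · have := ih y hy (hy.trans hx)
      simp [this.2.1, this.2.2]
    · simpa [hlead x hx] using lt_of_le_of_ne h1 (Ne.symm hne)

/-- At a first position `a` where the claim fails, the letter of colour `ι a` that comes next in the
sorted word, at `c ≥ a`, has leading exponent at most `leadExp ι k a` and equally many predecessors
of its colour. Its shifted letter is then at most the one of the other word at `a`, although
sortedness makes it at least the sorted word's own letter at `a`. -/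
theorem shiftedLetter_le {ι ι₀ : Fin m → I} {k k₀ : Fin m → ℤ}
    (hs₀ : StrictMono (shiftedLetter ι₀ k₀)) (τ : Equiv.Perm (Fin m))
    (hτ : ∀ a, ι a = ι₀ (τ a))
    (hle : toLex (fun a => leadExp ι₀ k₀ (τ a)) ≤ toLex (leadExp ι k)) :
    toLex (shiftedLetter ι₀ k₀) ≤ toLex (shiftedLetter ι k) := by
  by_contra hcon
  obtain ⟨a, ha, hlt⟩ := not_le.1 hcon
  have hpre : ∀ x < a, shiftedLetter ι k x = shiftedLetter ι₀ k₀ x := ha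
  have hag := leadExp_agree hs₀ τ hτ hle a hpre
  have hpa : leadExp ι₀ k₀ (τ a) ≤ leadExp ι k a := by
    by_contra h
    refine absurd hle (not_le.2 ⟨a, fun y hy => ?_, by simpa using h⟩)
    simp [(hag y hy).2.1, (hag y hy).2.2]
  obtain ⟨b, hb, hιb, hφb⟩ := exists_ge_of_agree (φ₀ := leadExp ι₀ k₀) τ hτ a
    (fun y hy => ⟨(hag y hy).1, (hag y hy).2.2⟩)
  -- The first occurrence of the colour from `a` on is needed, rather than `b`, so that the numbers
  -- of earlier letters of this colour agree.
  have hmin : ∃ c, a ≤ c ∧ ι₀ c = ι a ∧ c ≤ b ∧ ∀ x, a ≤ x → x < c → ι₀ x ≠ ι a := by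
    let C := Finset.univ.filter (fun c => a ≤ c ∧ ι₀ c = ι a)
    have hbC : b ∈ C := by simp [C, hb, hιb]
    refine ⟨C.min' ⟨b, hbC⟩, ?_, ?_, C.min'_le b hbC, fun x hx hlt hι => ?_⟩
    · exact (Finset.mem_filter.1 (C.min'_mem ⟨b, hbC⟩)).2.1
    · exact (Finset.mem_filter.1 (C.min'_mem ⟨b, hbC⟩)).2.2
    · exact absurd (C.min'_le x (by simp [C, hx, hι])) (not_le.2 hlt)
  obtain ⟨c, hac, hιc, hcb, hmin⟩ := hmin
  have hc : leadExp ι₀ k₀ c ≤ leadExp ι k a :=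
    ((leadExp_mono hs₀ hcb (hιc.trans hιb.symm)).trans hφb).trans hpa
  have hsame : sameBefore ι₀ c = sameBefore ι a := by
    rw [sameBefore, sameBefore]
    congr 1
    ext x
    simp only [Finset.mem_filter, Finset.mem_univ, true_and, hιc]
    constructor
    · rintro ⟨hx, hι⟩
      have hxa : x < a := by
        by_contra hxa
        exact hmin x (not_lt.1 hxa) hx hι
      exact ⟨hxa, (hag x hxa).1.trans hι⟩
    · rintro ⟨hx, hι⟩
      exact ⟨hx.trans_le hac, (hag x hx).1.symm.trans hι⟩
  have h1 : shiftedLetter ι₀ k₀ a ≤ shiftedLetter ι₀ k₀ c := hs₀.monotone hac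
  have h2 : shiftedLetter ι₀ k₀ c ≤ shiftedLetter ι k a := by
    rw [shiftedLetter, shiftedLetter, Prod.Lex.toLex_le_toLex, shiftedLetter_fst ι₀ k₀ c,
      shiftedLetter_fst ι k a, hsame, hιc]
    rcases hc.lt_or_eq with h | h
    · left; simpa using h
    · right; simp [h]
  exact absurd (h1.trans h2) (not_le.2 hlt)

/-- The equality case: in the pairing of a sorted word with its own dual element, only
rearrangements that fix the exponents survive. -/
theorem leadExp_comp_eq {ι : Fin m → I} {k : Fin m → ℤ}
    (hs : StrictMono (shiftedLetter ι k)) (τ : Equiv.Perm (Fin m))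
    (hτ : ∀ a, ι a = ι (τ a))
    (hle : toLex (fun a => leadExp ι k (τ a)) ≤ toLex (leadExp ι k)) :
    ∀ a, leadExp ι k (τ a) = leadExp ι k a := by
  intro a
  have hag := leadExp_agree (ι := ι) (k := k) hs τ hτ hle a (fun x _ => Eq.refl _)
  obtain ⟨b, hb, hιb, hφb⟩ := exists_ge_of_agree (φ₀ := leadExp ι k) τ hτ a
    (fun y hy => ⟨Eq.refl (ι y), (hag y hy).2.2⟩)
  refine le_antisymm ?_ ((leadExp_mono hs hb hιb.symm).trans hφb)
  by_contra h
  refine absurd hle (not_le.2 ⟨a, fun y hy => ?_, by simpa using h⟩)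
  simp [(hag y hy).2.2]

end LexCombinatorics

/-! ### Laurent polynomials, renaming of variables and products of differences -/

section RatFunLemmas

variable (K : Type*) [Field K] {σ τ υ I : Type*}

theorem z_ne_zero (s : σ) : z K s ≠ 0 := by
  rw [z, Ne, map_eq_zero_iff _ (IsFractionRing.injective _ _)]
  exact MvPolynomial.X_ne_zero s

variable {K} in
theorem ratFun_algHom_ext {L : Type*} [Field L] [Algebra K L] {f g : RatFun K σ →ₐ[K] L}
    (h : ∀ s, f (z K s) = g (z K s)) : f = g := by
  have h1 : f.comp (IsScalarTower.toAlgHom K (MvPolynomial σ K) (RatFun K σ)) =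
      g.comp (IsScalarTower.toAlgHom K (MvPolynomial σ K) (RatFun K σ)) :=
    MvPolynomial.algHom_ext h
  have h2 : (f : RatFun K σ →+* L) = g := by
    refine IsLocalization.ringHom_ext (nonZeroDivisors (MvPolynomial σ K)) (RingHom.ext fun p => ?_)
    exact DFunLike.congr_fun h1 p
  exact AlgHom.ext fun x => DFunLike.congr_fun h2 x

theorem relabel_z (β : σ ≃ τ) (s : σ) : relabel K β (z K s) = z K (β s) := by
  simp [relabel, z]

theorem relabel_relabel (β : σ ≃ τ) (γ : τ ≃ υ) (x : RatFun K σ) :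
    relabel K γ (relabel K β x) = relabel K (β.trans γ) x := by
  have h : ((relabel K γ).toAlgHom.comp (relabel K β).toAlgHom) =
      (relabel K (β.trans γ)).toAlgHom := by
    refine ratFun_algHom_ext fun s => ?_
    simp [relabel_z]
  exact DFunLike.congr_fun h x

theorem z_mem_laurent (s : σ) : z K s ∈ laurent K σ :=
  Algebra.subset_adjoin (Or.inl ⟨s, rfl⟩)

theorem z_zpow_mem_laurent (s : σ) (k : ℤ) : z K s ^ k ∈ laurent K σ := by
  cases k with
  | ofNat k => simpa using pow_mem (z_mem_laurent K s) k
  | negSucc k =>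
    rw [zpow_negSucc, ← inv_pow]
    have h : (z K s)⁻¹ ∈ laurent K σ := Algebra.subset_adjoin (Or.inr ⟨s, rfl⟩)
    exact pow_mem h _

theorem relabel_mem_laurent (β : σ ≃ τ) {x : RatFun K σ} (hx : x ∈ laurent K σ) :
    relabel K β x ∈ laurent K τ := by
  have h : laurent K σ ≤ (laurent K τ).comap (relabel K β).toAlgHom := by
    refine Algebra.adjoin_le ?_
    rintro _ (⟨s, rfl⟩ | ⟨s, rfl⟩)
    · simpa [relabel_z] using z_mem_laurent K (β s)
    · simpa [relabel_z] using z_zpow_mem_laurent K (β s) (-1)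
  exact h hx

/-- The product of the differences `z_s^ε - z_t^ε` over all pairs of variables whose colours
satisfy `c s < c t`. -/
noncomputable def pairProd [Fintype σ] [LinearOrder I] (ε : ℤˣ) (c : σ → I) : RatFun K σ :=
  ∏ p ∈ Finset.univ.filter (fun p : σ × σ => c p.1 < c p.2),
    (z K p.1 ^ (ε : ℤ) - z K p.2 ^ (ε : ℤ))

theorem prod_relabel_pairs [Fintype σ] [Fintype τ] [LinearOrder I] (β : σ ≃ τ) (c : τ → I)
    {M : Type*} [CommMonoid M] (F : τ × τ → M) :
    ∏ p ∈ Finset.univ.filter (fun p : σ × σ => c (β p.1) < c (β p.2)), F (β p.1, β p.2) =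
      ∏ p ∈ Finset.univ.filter (fun p : τ × τ => c p.1 < c p.2), F p :=
  Finset.prod_equiv (β.prodCongr β) (by simp) (by simp)

theorem relabel_pairProd [Fintype σ] [Fintype τ] [LinearOrder I] (ε : ℤˣ) (β : σ ≃ τ)
    (c : τ → I) : relabel K β (pairProd K ε fun s => c (β s)) = pairProd K ε c := by
  rw [pairProd, pairProd, ← prod_relabel_pairs β c, map_prod]
  simp [relabel_z]

theorem z_zpow_injective {ε : ℤˣ} {s t : σ} (h : z K s ^ (ε : ℤ) = z K t ^ (ε : ℤ)) : s = t := by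
  have h' : z K s = z K t := by
    rcases Int.units_eq_one_or ε with rfl | rfl
    · simpa using h
    · simpa using h
  rw [z, z] at h'
  exact MvPolynomial.X_injective (IsFractionRing.injective (MvPolynomial σ K) (RatFun K σ) h')

theorem pairProd_ne_zero [Fintype σ] [LinearOrder I] (ε : ℤˣ) (c : σ → I) :
    pairProd K ε c ≠ 0 := by
  refine Finset.prod_ne_zero_iff.2 fun p hp => sub_ne_zero.2 fun h => ?_
  rw [Finset.mem_filter, z_zpow_injective K h] at hp
  exact lt_irrefl _ hp.2

/-- Since `x⁻¹ - y⁻¹ = -(x - y) x⁻¹ y⁻¹`, the two products of differences differ by a sign times a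
Laurent monomial that is invariant under colour-preserving renamings. -/
theorem pairProd_eq_mul [Fintype σ] [LinearOrder I] (ε : ℤˣ) (c : σ → I) :
    ∃ u, (u ∈ laurent K σ ∧ u⁻¹ ∈ laurent K σ) ∧
      (∀ β : σ ≃ σ, (∀ s, c (β s) = c s) → relabel K β u = u) ∧
      pairProd K ε c = pairProd K 1 c * u := by
  rcases Int.units_eq_one_or ε with rfl | rfl
  · exact ⟨1, by simp [one_mem], by simp, by simp⟩
  · refine ⟨∏ p ∈ Finset.univ.filter (fun p : σ × σ => c p.1 < c p.2),
      (-(z K p.1 ^ (-1 : ℤ) * z K p.2 ^ (-1 : ℤ))), ⟨?_, ?_⟩, fun β hβ => ?_, ?_⟩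
    · exact prod_mem fun p _ => neg_mem (mul_mem (z_zpow_mem_laurent K _ _)
        (z_zpow_mem_laurent K _ _))
    · rw [← Finset.prod_inv_distrib]
      refine prod_mem fun p _ => ?_
      rw [inv_neg, mul_inv, ← zpow_neg, ← zpow_neg]
      exact neg_mem (mul_mem (z_zpow_mem_laurent K _ _) (z_zpow_mem_laurent K _ _))
    · conv_rhs => rw [← prod_relabel_pairs β c]
      rw [map_prod]
      simp [relabel_z, hβ]
    · rw [pairProd, pairProd, ← Finset.prod_mul_distrib]
      refine Finset.prod_congr rfl fun p _ => ?_
      have h1 := z_ne_zero K p.1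
      have h2 := z_ne_zero K p.2
      simp only [Units.val_neg, Units.val_one, zpow_neg, zpow_one]
      field_simp
      ring

end RatFunLemmas

/-! ### The components of `V` and their colour-preserving symmetries -/

section BigShuffleLemmas

variable (K : Type*) [Field K] {I : Type*}

theorem exists_sigmaCongrRight_eq {n : I → ℕ} (γ : Vars n ≃ Vars n) (hγ : ∀ s, (γ s).1 = s.1) :
    ∃ π : ∀ i, Equiv.Perm (Fin (n i)), Equiv.sigmaCongrRight π = γ := by
  refine ⟨fun i => (Equiv.sigmaSubtype i).symm.trans
    ((γ.subtypeEquiv fun s => by rw [hγ]).trans (Equiv.sigmaSubtype i)), ?_⟩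
  ext1 ⟨i, a⟩
  have h : ∀ (s : Vars n) (hs : s.1 = i), (⟨i, hs ▸ s.2⟩ : Vars n) = s := by
    rintro ⟨j, b⟩ rfl
    rfl
  exact h (γ ⟨i, a⟩) (hγ _)

variable {K} in
theorem relabel_eq_of_mem_symLaurent {n : I → ℕ} {r : RatFun K (Vars n)} (hr : r ∈ symLaurent K n)
    (γ : Vars n ≃ Vars n) (hγ : ∀ s, (γ s).1 = s.1) : relabel K γ r = r := by
  obtain ⟨π, rfl⟩ := exists_sigmaCongrRight_eq γ hγ
  exact hr.2 π

variable {K} in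
theorem mem_symLaurent_iff {n : I → ℕ} {r : RatFun K (Vars n)} :
    r ∈ symLaurent K n ↔ r ∈ laurent K (Vars n) ∧
      ∀ γ : Vars n ≃ Vars n, (∀ s, (γ s).1 = s.1) → relabel K γ r = r :=
  ⟨fun h => ⟨h.1, fun γ hγ => relabel_eq_of_mem_symLaurent h γ hγ⟩,
    fun h => ⟨h.1, fun _ => h.2 _ fun _ => rfl⟩⟩

theorem exists_equiv_of_content_eq [DecidableEq I] {n : I → ℕ} {m : ℕ} {ι : Fin m → I}
    (h : n = ∑ a : Fin m, Pi.single (ι a) 1) :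
    ∃ β : Fin m ≃ Vars n, ∀ a, (β a).1 = ι a := by
  have hcard : ∀ i, Fintype.card {a // ι a = i} = Fintype.card (Fin (n i)) := by
    intro i
    rw [h, Finset.sum_apply, Fintype.card_fin, Fintype.card_subtype, Finset.card_filter]
    simp only [Pi.single_apply, eq_comm]
  refine ⟨(Equiv.sigmaFiberEquiv ι).symm.trans
    (Equiv.sigmaCongrRight fun i => Fintype.equivOfCardEq (hcard i)), fun a => ?_⟩
  rfl

variable [Fintype I] [LinearOrder I]

theorem denom_eq_pairProd (n : I → ℕ) :
    denom K n = pairProd K 1 (Sigma.fst : Vars n → I) := by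
  have h : ∀ (x y : Vars n), z K x ^ ((1 : ℤˣ) : ℤ) - z K y ^ ((1 : ℤˣ) : ℤ) = z K x - z K y := by
    simp
  simp only [pairProd, h, denom]
  rw [Finset.prod_filter, ← Finset.univ_product_univ, Finset.prod_product]
  rw [Finset.univ_sigma_univ.symm, Finset.prod_sigma]
  refine Finset.prod_congr rfl fun i _ => ?_
  rw [Finset.prod_comm' (t' := Finset.univ) (s' := fun _ => Finset.univ.filter (fun j => i < j))
    (by simp)]
  refine Finset.prod_congr rfl fun a _ => ?_
  rw [Finset.prod_sigma, Finset.prod_filter]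
  refine Finset.prod_congr rfl fun j _ => ?_
  split_ifs <;> simp

variable {K} in
-- The denominators may be written in the variables `z_s^ε`, in which the expansion takes place.
theorem mem_VComp_iff (ε : ℤˣ) {n : I → ℕ} {R : RatFun K (Vars n)} :
    R ∈ VComp K n ↔ R * pairProd K ε (Sigma.fst : Vars n → I) ∈ symLaurent K n := by
  obtain ⟨u, ⟨hu, hu'⟩, hinv, hprod⟩ := pairProd_eq_mul K ε (Sigma.fst : Vars n → I)
  have hne := pairProd_ne_zero K 1 (Sigma.fst : Vars n → I)
  have hu0 : u ≠ 0 := by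
    rintro rfl
    exact pairProd_ne_zero K ε (Sigma.fst : Vars n → I) (by rw [hprod, mul_zero])
  rw [VComp, Submodule.mem_map, denom_eq_pairProd]
  constructor
  · rintro ⟨r, hr, rfl⟩
    rw [mem_symLaurent_iff] at hr ⊢
    have : LinearMap.mulRight K (pairProd K 1 (Sigma.fst : Vars n → I))⁻¹ r *
        pairProd K ε (Sigma.fst : Vars n → I) = r * u := by
      rw [LinearMap.mulRight_apply, hprod]
      field_simp
    rw [this]
    exact ⟨mul_mem hr.1 hu, fun γ hγ => by rw [map_mul, hr.2 γ hγ, hinv γ hγ]⟩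
  · intro h
    rw [mem_symLaurent_iff] at h
    refine ⟨R * pairProd K ε (Sigma.fst : Vars n → I) * u⁻¹, mem_symLaurent_iff.2
      ⟨mul_mem h.1 hu', fun γ hγ => by rw [map_mul, h.2 γ hγ, map_inv₀, hinv γ hγ]⟩, ?_⟩
    rw [LinearMap.mulRight_apply, hprod]
    field_simp

variable {K} in
theorem relabel_eq_of_mem_VComp {n : I → ℕ} {R : RatFun K (Vars n)} (hR : R ∈ VComp K n)
    (γ : Vars n ≃ Vars n) (hγ : ∀ s, (γ s).1 = s.1) : relabel K γ R = R := by
  have h := relabel_eq_of_mem_symLaurent ((mem_VComp_iff 1).1 hR) γ hγ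
  have hp := relabel_pairProd K 1 γ (Sigma.fst : Vars n → I)
  simp only [hγ] at hp
  rw [map_mul, hp] at h
  exact mul_right_cancel₀ (pairProd_ne_zero K 1 (Sigma.fst : Vars n → I)) h

variable {K} in
theorem relabel_symm_eq_of_mem_VComp {n : I → ℕ} {R : RatFun K (Vars n)} (hR : R ∈ VComp K n)
    {τ : Type*} (β β' : τ ≃ Vars n) (h : ∀ a, (β a).1 = (β' a).1) :
    relabel K β.symm R = relabel K β'.symm R := by
  have h1 := relabel_eq_of_mem_VComp hR (β.symm.trans β') (fun s => by simp [← h])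
  conv_rhs => rw [← h1, relabel_relabel]
  congr 2
  ext x
  simp

theorem content_eq {n : I → ℕ} {m : ℕ} {ι : Fin m → I} (β : Fin m ≃ Vars n)
    (hβ : ∀ a, (β a).1 = ι a) : n = ∑ a : Fin m, Pi.single (ι a) 1 := by
  funext i
  rw [Finset.sum_apply]
  simp only [Pi.single_apply, ← hβ]
  rw [Equiv.sum_comp β (fun s => if i = s.1 then 1 else 0), Fintype.sum_sigma,
    Finset.sum_eq_single i]
  · simp
  · intro j _ hj
    simp [Ne.symm hj]
  · simp

end BigShuffleLemmas

/-! ### Monomials and variables in the field of Hahn series -/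

section ExpansionLemmas

variable (K : Type*) [Field K] {m : ℕ}

/-- The monomial with exponent `v`, as a Hahn series. -/
noncomputable def mono (v : Fin m → ℤ) : HahnSeries (Lex (Fin m → ℤ)) K :=
  HahnSeries.single (toLex v) 1

/-- The variables `t_a` of the Hahn series field. -/
noncomputable def tvar (a : Fin m) : HahnSeries (Lex (Fin m → ℤ)) K := mono K (Pi.single a 1)

theorem mono_add (u v : Fin m → ℤ) : mono K (u + v) = mono K u * mono K v := by
  rw [mono, mono, mono, HahnSeries.single_mul_single, one_mul]
  rfl

theorem mono_zero : mono K (0 : Fin m → ℤ) = 1 := rfl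

theorem mono_ne_zero (v : Fin m → ℤ) : mono K v ≠ 0 :=
  HahnSeries.single_ne_zero one_ne_zero

theorem mono_neg (v : Fin m → ℤ) : mono K (-v) = (mono K v)⁻¹ := by
  exact eq_inv_of_mul_eq_one_left (by rw [← mono_add, neg_add_cancel, mono_zero])

theorem mono_zsmul (k : ℤ) (v : Fin m → ℤ) : mono K (k • v) = mono K v ^ k := by
  have hnat : ∀ k : ℕ, mono K (k • v) = mono K v ^ k := by
    intro k
    induction k with
    | zero => simp [mono_zero]
    | succ k ih => rw [succ_nsmul, mono_add, ih, pow_succ]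
  cases k with
  | ofNat k => simpa using hnat k
  | negSucc k => rw [negSucc_zsmul, mono_neg, hnat, zpow_negSucc]

theorem mono_eq_prod (v : Fin m → ℤ) : mono K v = ∏ a, tvar K a ^ v a := by
  have h : ∀ s : Finset (Fin m), mono K (∑ a ∈ s, v a • (Pi.single a 1 : Fin m → ℤ)) =
      ∏ a ∈ s, tvar K a ^ v a := by
    intro s
    induction s using Finset.induction_on with
    | empty => simp [mono_zero]
    | insert a s ha ih =>
      rw [Finset.sum_insert ha, Finset.prod_insert ha, mono_add, ih, mono_zsmul, tvar]
  rw [← h]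
  congr 1
  funext b
  simp [Finset.sum_apply, Pi.single_apply]

theorem expand_z_zpow (ε : ℤˣ) (a : Fin m) : expand K m ε (z K a ^ (ε : ℤ)) = tvar K a := by
  have h : expand K m ε (z K a) = mono K (Pi.single a (ε : ℤ)) := by
    rw [expand, z, IsFractionRing.lift_algebraMap]
    simp [expandPoly, mono]
  rw [map_zpow₀, h, ← mono_zsmul, tvar]
  congr 1
  rw [← Pi.single_smul, smul_eq_mul]
  rcases Int.units_eq_one_or ε with rfl | rfl <;> simp

theorem expand_algebraMap (ε : ℤˣ) (c : K) :
    expand K m ε (algebraMap K (RatFun K (Fin m)) c) = HahnSeries.C c := by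
  rw [IsScalarTower.algebraMap_apply K (MvPolynomial (Fin m) K), expand,
    IsFractionRing.lift_algebraMap]
  simp [HahnSeries.algebraMap_apply]

theorem coeff_C_mul (c : K) (x : HahnSeries (Lex (Fin m → ℤ)) K) (v : Lex (Fin m → ℤ)) :
    (HahnSeries.C c * x).coeff v = c * x.coeff v := by
  rw [HahnSeries.C_mul_eq_smul]
  rfl

theorem coeff_mono_mul (u v : Fin m → ℤ) (x : HahnSeries (Lex (Fin m → ℤ)) K) :
    (mono K u * x).coeff (toLex v) = x.coeff (toLex (v - u)) := by
  have h := HahnSeries.coeff_single_mul_add (r := (1 : K)) (x := x) (a := toLex (v - u))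
    (b := toLex u)
  rw [one_mul] at h
  rw [← h, mono]
  congr 1
  rw [← toLex_add, sub_add_cancel]

end ExpansionLemmas

/-! ### Expansions that agree up to a permutation of the exponents -/

section CoordinateSwap

variable {K : Type*} [Field K] {m : ℕ}

/-- The second Hahn series is obtained from the first by a permutation of the coordinates of the
exponents. -/
def IsPermuted (s : Equiv.Perm (Fin m)) (x y : HahnSeries (Lex (Fin m → ℤ)) K) : Prop :=
  ∀ v : Fin m → ℤ, x.coeff (toLex v) = y.coeff (toLex (v ∘ s))

variable {s : Equiv.Perm (Fin m)} {x y x' y' : HahnSeries (Lex (Fin m → ℤ)) K}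

theorem IsPermuted.add (h : IsPermuted s x y) (h' : IsPermuted s x' y') :
    IsPermuted s (x + x') (y + y') := fun v => by
  rw [HahnSeries.coeff_add, HahnSeries.coeff_add, h v, h' v]

theorem IsPermuted.neg (h : IsPermuted s x y) : IsPermuted s (-x) (-y) := fun v => by
  rw [HahnSeries.coeff_neg, HahnSeries.coeff_neg, h v]

theorem IsPermuted.one : IsPermuted s (1 : HahnSeries (Lex (Fin m → ℤ)) K) 1 := fun v => by
  have h : toLex v = 0 ↔ toLex (v ∘ s) = 0 := by
    constructor
    · intro h
      have h' : v = 0 := h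
      rw [h']
      rfl
    · intro h
      have h' : v ∘ s = 0 := h
      have : v = (v ∘ s) ∘ s.symm := by ext; simp
      rw [this, h']
      rfl
  simp only [HahnSeries.coeff_one]
  split_ifs with h1 h2 h2
  · rfl
  · exact absurd (h.1 h1) h2
  · exact absurd (h.2 h2) h1
  · rfl

/-- A permutation of coordinates does not preserve the lexicographic order, so it does not act on
all Hahn series; hence a relation between two given series. It respects products because it matches
the pairs of exponents in the two finite convolution sums. -/
theorem IsPermuted.mul (h : IsPermuted s x y) (h' : IsPermuted s x' y') :
    IsPermuted s (x * x') (y * y') := fun v => by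
  have hx' : ∀ w : Fin m → ℤ, y.coeff (toLex w) = x.coeff (toLex (w ∘ s.symm)) := fun w => by
    rw [h]; congr 2; ext; simp
  have hy' : ∀ w : Fin m → ℤ, y'.coeff (toLex w) = x'.coeff (toLex (w ∘ s.symm)) := fun w => by
    rw [h']; congr 2; ext; simp
  rw [HahnSeries.coeff_mul, HahnSeries.coeff_mul]
  refine Finset.sum_nbij'
    (fun p => (toLex (ofLex p.1 ∘ s), toLex (ofLex p.2 ∘ s)))
    (fun p => (toLex (ofLex p.1 ∘ s.symm), toLex (ofLex p.2 ∘ s.symm))) ?_ ?_ ?_ ?_ ?_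
  · rintro ⟨p, p'⟩ hp
    rw [Finset.mem_antidiagonal] at hp ⊢
    refine ⟨?_, ?_, ?_⟩
    · rw [HahnSeries.mem_support, ← h]
      exact hp.1
    · rw [HahnSeries.mem_support, ← h']
      exact hp.2.1
    · have h3 : ofLex p + ofLex p' = v := hp.2.2
      rw [← h3]
      rfl
  · rintro ⟨p, p'⟩ hp
    rw [Finset.mem_antidiagonal] at hp ⊢
    refine ⟨?_, ?_, ?_⟩
    · rw [HahnSeries.mem_support, ← hx']
      exact hp.1
    · rw [HahnSeries.mem_support, ← hy']
      exact hp.2.1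
    · have h3 : ofLex p + ofLex p' = v ∘ s := hp.2.2
      have h4 : v = (ofLex p + ofLex p') ∘ s.symm := by rw [h3]; ext; simp
      rw [h4]
      rfl
  · rintro ⟨p, p'⟩ _
    ext : 1
    · change toLex ((ofLex p ∘ s) ∘ s.symm) = p
      simp [Function.comp_assoc]
    · change toLex ((ofLex p' ∘ s) ∘ s.symm) = p'
      simp [Function.comp_assoc]
  · rintro ⟨p, p'⟩ _
    ext : 1
    · change toLex ((ofLex p ∘ s.symm) ∘ s) = p
      simp [Function.comp_assoc]
    · change toLex ((ofLex p' ∘ s.symm) ∘ s) = p'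
      simp [Function.comp_assoc]
  · rintro ⟨p, p'⟩ _
    exact congrArg₂ (· * ·) (h (ofLex p)) (h' (ofLex p'))

theorem IsPermuted.pow (h : IsPermuted s x y) (n : ℕ) : IsPermuted s (x ^ n) (y ^ n) := by
  induction n with
  | zero => simpa using IsPermuted.one
  | succ n ih => simpa [pow_succ] using ih.mul h

theorem isPermuted_C (s : Equiv.Perm (Fin m)) (c : K) :
    IsPermuted s (HahnSeries.C c) (HahnSeries.C c) := by
  intro v
  have h := IsPermuted.one (K := K) (s := s) v
  have h1 := coeff_C_mul K c 1 (toLex v)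
  have h2 := coeff_C_mul K c 1 (toLex (v ∘ s))
  rw [mul_one] at h1 h2
  rw [h1, h2]
  exact congrArg (c * ·) h

theorem isPermuted_mono (s : Equiv.Perm (Fin m)) (u : Fin m → ℤ) :
    IsPermuted s (mono K u) (mono K (u ∘ s)) := by
  intro v
  simp only [mono]
  by_cases h : v = u
  · subst h
    simp
  · rw [HahnSeries.coeff_single_of_ne (fun h' => h (toLex.injective h')),
      HahnSeries.coeff_single_of_ne]
    intro h'
    exact h (s.surjective.injective_comp_right (toLex.injective h'))

/-- Both inverses are geometric series, compared power by power. Positivity is required on both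
sides, since it is not inherited under the permutation. -/
theorem isPermuted_inv_one_sub (s : Equiv.Perm (Fin m))
    {x y : HahnSeries (Lex (Fin m → ℤ)) K} (h : IsPermuted s x y)
    (hx : 0 < x.orderTop) (hy : 0 < y.orderTop) :
    IsPermuted s ((1 - x)⁻¹) ((1 - y)⁻¹) := by
  rw [← eq_inv_of_mul_eq_one_right (HahnSeries.SummableFamily.one_sub_self_mul_hsum_powers hx),
    ← eq_inv_of_mul_eq_one_right (HahnSeries.SummableFamily.one_sub_self_mul_hsum_powers hy)]
  intro v
  simp only [HahnSeries.SummableFamily.coeff_hsum]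
  refine finsum_congr fun n => ?_
  rw [HahnSeries.SummableFamily.powers_of_orderTop_pos hx,
    HahnSeries.SummableFamily.powers_of_orderTop_pos hy]
  exact h.pow n v

theorem toLex_single_lt {a b : Fin m} (h : a < b) :
    toLex (Pi.single b 1 : Fin m → ℤ) < toLex (Pi.single a 1) := by
  refine ⟨a, fun j hj => ?_, ?_⟩
  · simp [hj.ne, (hj.trans h).ne]
  · simp [h.ne]

theorem tvar_ne_zero (a : Fin m) : tvar K a ≠ 0 := mono_ne_zero K _

theorem tvar_mul_tvar_inv (a b : Fin m) :
    tvar K a * (tvar K b)⁻¹ = mono K (Pi.single a 1 - Pi.single b 1) := by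
  rw [tvar, tvar, ← mono_neg, ← mono_add, sub_eq_add_neg]

theorem C_ne_zero {c : K} (hc : c ≠ 0) :
    (HahnSeries.C c : HahnSeries (Lex (Fin m → ℤ)) K) ≠ 0 := by
  rwa [Ne, map_eq_zero]

theorem orderTop_C_mul_tvar_pos {a b : Fin m} (h : a < b) {c : K} (hc : c ≠ 0) :
    0 < (HahnSeries.C c * (tvar K a * (tvar K b)⁻¹)).orderTop := by
  rw [tvar_mul_tvar_inv, mono, HahnSeries.C_apply, HahnSeries.single_mul_single, zero_add, mul_one,
    HahnSeries.orderTop_single hc]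
  rw [← WithTop.coe_zero, WithTop.coe_lt_coe]
  exact sub_pos.2 (toLex_single_lt h)

theorem isPermuted_tvar (s : Equiv.Perm (Fin m)) (k : ℤ) (a : Fin m) :
    IsPermuted s (tvar K a ^ k) (tvar K (s.symm a) ^ k) := by
  rw [tvar, tvar, ← mono_zsmul, ← mono_zsmul]
  convert isPermuted_mono (K := K) s (k • (Pi.single a 1 : Fin m → ℤ)) using 2
  congr 1
  ext b
  simp [Pi.single_apply, Equiv.eq_symm_apply]

theorem tvar_sub_ne_zero {a b : Fin m} (h : a < b) {c : K} (hc : c ≠ 0) :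
    tvar K a - HahnSeries.C c * tvar K b ≠ 0 := by
  intro h0
  have h1 := orderTop_C_mul_tvar_pos (K := K) h (inv_ne_zero hc)
  have hb := tvar_ne_zero (K := K) b
  have h2 : HahnSeries.C c⁻¹ * (tvar K a * (tvar K b)⁻¹) = 1 := by
    rw [sub_eq_zero.1 h0, mul_assoc, mul_inv_cancel₀ hb, mul_one, ← map_mul, inv_mul_cancel₀ hc,
      map_one]
  rw [h2, HahnSeries.orderTop_one] at h1
  exact lt_irrefl _ h1

/-- As long as `a`, `b` keep their order, both inverses are expanded in powers of the earlier
variable over the later one. -/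
theorem isPermuted_inv_tvar_sub (s : Equiv.Perm (Fin m)) {a b : Fin m} (h : a < b)
    (hs : s.symm a < s.symm b) {c : K} (hc : c ≠ 0) :
    IsPermuted s ((tvar K a - HahnSeries.C c * tvar K b)⁻¹) ((tvar K (s.symm a) - HahnSeries.C c * tvar K (s.symm b))⁻¹) := by
  have key : ∀ a b : Fin m, (tvar K a - HahnSeries.C c * tvar K b)⁻¹ =
      HahnSeries.C (-c)⁻¹ * tvar K b ^ (-1 : ℤ) *
        (1 - HahnSeries.C c⁻¹ * (tvar K a ^ (1 : ℤ) * tvar K b ^ (-1 : ℤ)))⁻¹ := by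
    intro a b
    have hb := tvar_ne_zero (K := K) b
    have hC : (HahnSeries.C c : HahnSeries (Lex (Fin m → ℤ)) K) ≠ 0 := C_ne_zero hc
    have : tvar K a - HahnSeries.C c * tvar K b = HahnSeries.C (-c) * tvar K b *
        (1 - HahnSeries.C c⁻¹ * (tvar K a ^ (1 : ℤ) * tvar K b ^ (-1 : ℤ))) := by
      rw [map_inv₀, map_neg, zpow_neg, zpow_one, zpow_one]
      field_simp
      ring
    rw [this, mul_inv, mul_inv, map_inv₀ HahnSeries.C (-c), zpow_neg, zpow_one, zpow_one]
  rw [key, key]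
  have hC := isPermuted_C (K := K) s
  have hT := isPermuted_tvar (K := K) s
  refine IsPermuted.mul (IsPermuted.mul (hC _) (hT (-1) b))
    (isPermuted_inv_one_sub s (IsPermuted.mul (hC c⁻¹)
      (IsPermuted.mul (hT 1 a) (hT (-1) b))) ?_ ?_)
  · simpa using orderTop_C_mul_tvar_pos h (inv_ne_zero hc)
  · simpa using orderTop_C_mul_tvar_pos hs (inv_ne_zero hc)

theorem expand_z_zpow_eq (ε : ℤˣ) (a : Fin m) (k : ℤ) :
    expand K m ε (z K a ^ k) = tvar K a ^ ((ε : ℤ) * k) := by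
  rw [← expand_z_zpow K ε a, ← map_zpow₀, ← zpow_mul]
  congr 2
  rcases Int.units_eq_one_or ε with rfl | rfl <;> simp

theorem isPermuted_expand (ε : ℤˣ) (s : Equiv.Perm (Fin m)) {L : RatFun K (Fin m)}
    (hL : L ∈ laurent K (Fin m)) :
    IsPermuted s (expand K m ε L) (expand K m ε (relabel K s.symm L)) := by
  have hz := expand_z_zpow_eq (K := K) (m := m) ε
  induction hL using Algebra.adjoin_induction with
  | mem x hx =>
    rcases hx with ⟨a, rfl⟩ | ⟨a, rfl⟩
    · have h := isPermuted_tvar (K := K) s ((ε : ℤ) * 1) a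
      rw [← hz, ← hz] at h
      simpa [relabel_z] using h
    · have h := isPermuted_tvar (K := K) s ((ε : ℤ) * -1) a
      rw [← hz, ← hz] at h
      simpa [relabel_z] using h
  | algebraMap c =>
    rw [AlgEquiv.commutes, expand_algebraMap]
    exact isPermuted_C s c
  | add x y _ _ hx hy =>
    rw [map_add, map_add, map_add]
    exact hx.add hy
  | mul x y _ _ hx hy =>
    rw [map_mul, map_mul, map_mul]
    exact hx.mul hy

theorem isPermuted_prod (s : Equiv.Perm (Fin m)) {α : Type*} (A : Finset α)
    {x y : α → HahnSeries (Lex (Fin m → ℤ)) K} (h : ∀ a ∈ A, IsPermuted s (x a) (y a)) :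
    IsPermuted s (∏ a ∈ A, x a) (∏ a ∈ A, y a) := by
  classical
  induction A using Finset.induction_on with
  | empty => exact IsPermuted.one
  | insert a A ha ih =>
    rw [Finset.prod_insert ha, Finset.prod_insert ha]
    exact IsPermuted.mul (h a (Finset.mem_insert_self a A))
      (ih fun b hb => h b (Finset.mem_insert_of_mem hb))

end CoordinateSwap

/-! ### The kernel and the exchange of two adjacent variables -/

section Kernel

variable {K : Type*} [Field K] {m : ℕ} {I : Type*}

/-- The expansion of `∏_{a < b} ζ_{i_a i_b}(t_a / t_b)⁻¹`. -/
noncomputable def kernel (d : Matrix I I ℤ) (q : K) (ι : Fin m → I) :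
    HahnSeries (Lex (Fin m → ℤ)) K :=
  ∏ p ∈ Finset.univ.filter (fun p : Fin m × Fin m => p.1 < p.2),
    (tvar K p.1 - tvar K p.2) *
      (tvar K p.1 - HahnSeries.C (q ^ (-d (ι p.1) (ι p.2))) * tvar K p.2)⁻¹

/-- The constant term of `t^{-k} F ∏_{a < b} ζ_{i_a i_b}(t_a / t_b)⁻¹`. -/
noncomputable def pairCoeff (ε : ℤˣ) (d : Matrix I I ℤ) (q : K) (ι : Fin m → I) (k : Fin m → ℤ)
    (F : RatFun K (Fin m)) : K :=
  (mono K (-k) * (expand K m ε F * kernel d q ι)).coeff 0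

theorem prod_lt_pairs {M : Type*} [CommMonoid M] (F : Fin m → Fin m → M) :
    ∏ a : Fin m, ∏ b ∈ Finset.univ.filter (fun b : Fin m => a < b), F a b =
      ∏ p ∈ Finset.univ.filter (fun p : Fin m × Fin m => p.1 < p.2), F p.1 p.2 := by
  rw [Finset.prod_filter, ← Finset.univ_product_univ, Finset.prod_product]
  exact Finset.prod_congr rfl fun a _ => by rw [Finset.prod_filter]

theorem expand_zeta_inv (ε : ℤˣ) (d : Matrix I I ℤ) (q : K) (i j : I) {a b : Fin m} (x : RatFun K (Fin m)) (hx : expand K m ε x = tvar K a / tvar K b) :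
    (expand K m ε (zeta d q i j x))⁻¹ = (tvar K a - tvar K b) *
      (tvar K a - HahnSeries.C (q ^ (-d i j)) * tvar K b)⁻¹ := by
  have hb := tvar_ne_zero (K := K) b
  rw [zeta, map_div₀, map_sub, map_sub, expand_algebraMap, hx, map_one, inv_div]
  rw [div_sub_one hb, div_sub' hb, div_div_div_cancel_right₀ hb, div_eq_mul_inv]
  rw [mul_comm (tvar K b)]

/-- With `t_a = z_a⁻¹` one has `z_b / z_a = t_a / t_b`, and the symmetry of `d` exchanges the two
indices of `ζ`. -/
theorem integralDesc_integrandPlus {d : Matrix I I ℤ} (hd : ∀ i j, d i j = d j i) (q : K)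
    (ι : Fin m → I) (k : Fin m → ℤ) (F : RatFun K (Fin m)) :
    integralDesc K (integrandPlus d q ι k F) = pairCoeff (-1) d q ι k F := by
  rw [integralDesc, integrandPlus, pairCoeff, kernel, div_eq_mul_inv, map_mul, map_mul, map_inv₀,
    map_prod, map_prod, mul_assoc, mono_eq_prod]
  congr 2
  · exact Finset.prod_congr rfl fun a _ => by rw [expand_z_zpow_eq]; simp
  congr 1
  rw [← Finset.prod_inv_distrib, ← prod_lt_pairs (fun a b => (tvar K a - tvar K b) *
      (tvar K a - HahnSeries.C (q ^ (-d (ι a) (ι b))) * tvar K b)⁻¹)]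
  refine Finset.prod_congr rfl fun a _ => ?_
  rw [map_prod, ← Finset.prod_inv_distrib]
  refine Finset.prod_congr rfl fun b _ => ?_
  rw [hd (ι a), expand_zeta_inv (-1) d q (ι b) (ι a) (a := a) (b := b)]
  have h := expand_z_zpow_eq (K := K) (m := m) (-1)
  have ha := h a 1
  have hb := h b 1
  simp only [zpow_one] at ha hb
  rw [map_div₀, ha, hb]
  simp [div_eq_mul_inv, mul_comm]

theorem integralAsc_integrandMinus (d : Matrix I I ℤ) (q : K)
    (ι : Fin m → I) (k : Fin m → ℤ) (F : RatFun K (Fin m)) :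
    integralAsc K (integrandMinus d q ι k F) = pairCoeff 1 d q ι k F := by
  rw [integralAsc, integrandMinus, pairCoeff, kernel, div_eq_mul_inv, map_mul, map_mul, map_inv₀,
    map_prod, map_prod, mul_assoc, mono_eq_prod]
  congr 2
  · exact Finset.prod_congr rfl fun a _ => by rw [expand_z_zpow_eq]; simp
  congr 1
  rw [← Finset.prod_inv_distrib, ← prod_lt_pairs (fun a b => (tvar K a - tvar K b) *
      (tvar K a - HahnSeries.C (q ^ (-d (ι a) (ι b))) * tvar K b)⁻¹)]
  refine Finset.prod_congr rfl fun a _ => ?_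
  rw [map_prod, ← Finset.prod_inv_distrib]
  refine Finset.prod_congr rfl fun b _ => ?_
  rw [expand_zeta_inv 1 d q (ι a) (ι b) (a := a) (b := b)]
  have h := expand_z_zpow_eq (K := K) (m := m) 1
  have ha := h a 1
  have hb := h b 1
  simp only [zpow_one] at ha hb
  rw [map_div₀, ha, hb]
  simp

/-- An adjacent transposition reverses the order of one pair only. Hence a single kernel factor
obstructs the comparison of the two expansions. -/
theorem swap_lt_swap {c c' : Fin m} (hc : (c : ℕ) + 1 = c') {a b : Fin m} (hab : a < b)
    (h : (a, b) ≠ (c, c')) : Equiv.swap c c' a < Equiv.swap c c' b := by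
  have h' : ¬ (a = c ∧ b = c') := fun h' => h (by rw [h'.1, h'.2])
  rw [Equiv.swap_apply_def, Equiv.swap_apply_def]
  simp only [Fin.lt_def, Fin.ext_iff] at *
  split_ifs <;> omega

theorem isPermuted_tvar_swap (c c' : Fin m) (a : Fin m) :
    IsPermuted (Equiv.swap c c') (tvar K a) (tvar K (Equiv.swap c c' a)) := by
  simpa using isPermuted_tvar (K := K) (Equiv.swap c c') 1 a

theorem IsPermuted.sub {s : Equiv.Perm (Fin m)} {x y x' y' : HahnSeries (Lex (Fin m → ℤ)) K}
    (h : IsPermuted s x y) (h' : IsPermuted s x' y') : IsPermuted s (x - x') (y - y') := by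
  rw [sub_eq_add_neg, sub_eq_add_neg]
  exact h.add h'.neg

theorem isPermuted_inv_tvar_sub_swap {c c' : Fin m} (hc : (c : ℕ) + 1 = c') {a b : Fin m}
    (hab : a < b) (h : (a, b) ≠ (c, c')) {κ : K} (hκ : κ ≠ 0) :
    IsPermuted (Equiv.swap c c') ((tvar K a - HahnSeries.C κ * tvar K b)⁻¹)
      ((tvar K (Equiv.swap c c' a) - HahnSeries.C κ * tvar K (Equiv.swap c c' b))⁻¹) := by
  have := isPermuted_inv_tvar_sub (K := K) (Equiv.swap c c') hab
    (by simpa using swap_lt_swap hc hab h) hκ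
  simpa using this

/-- The part of the kernel that has no pole when the exponents `c`, `c'` are swapped. -/
theorem exists_kernel_eq {c c' : Fin m} (hc : (c : ℕ) + 1 = c') (d : Matrix I I ℤ) {q : K}
    (hq : q ≠ 0) (ι : Fin m → I) :
    ∃ x y, IsPermuted (Equiv.swap c c') x y ∧
      kernel d q ι = ((tvar K c - tvar K c') *
        (tvar K c - HahnSeries.C (q ^ (-d (ι c) (ι c'))) * tvar K c')⁻¹) * x ∧
      kernel d q (ι ∘ Equiv.swap c c') = ((tvar K c - tvar K c') *
        (tvar K c - HahnSeries.C (q ^ (-d (ι c') (ι c))) * tvar K c')⁻¹) * y := by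
  set s := Equiv.swap c c' with hs
  have hlt : c < c' := by rw [Fin.lt_def]; omega
  have hmem : (c, c') ∈ Finset.univ.filter (fun p : Fin m × Fin m => p.1 < p.2) := by
    simpa using hlt
  refine ⟨∏ p ∈ (Finset.univ.filter (fun p : Fin m × Fin m => p.1 < p.2)).erase (c, c'),
    (tvar K p.1 - tvar K p.2) *
      (tvar K p.1 - HahnSeries.C (q ^ (-d (ι p.1) (ι p.2))) * tvar K p.2)⁻¹,
    ∏ p ∈ (Finset.univ.filter (fun p : Fin m × Fin m => p.1 < p.2)).erase (c, c'),
    (tvar K (s p.1) - tvar K (s p.2)) *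
      (tvar K (s p.1) - HahnSeries.C (q ^ (-d (ι p.1) (ι p.2))) * tvar K (s p.2))⁻¹,
    isPermuted_prod s _ fun p hp => ?_, ?_, ?_⟩
  · rw [Finset.mem_erase, Finset.mem_filter] at hp
    exact ((isPermuted_tvar_swap c c' p.1).sub (isPermuted_tvar_swap c c' p.2)).mul
      (isPermuted_inv_tvar_sub_swap hc hp.2.2 hp.1 (zpow_ne_zero _ hq))
  · rw [kernel, Finset.mul_prod_erase _ (fun p : Fin m × Fin m => (tvar K p.1 - tvar K p.2) *
      (tvar K p.1 - HahnSeries.C (q ^ (-d (ι p.1) (ι p.2))) * tvar K p.2)⁻¹) hmem]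
  · rw [kernel, ← Finset.mul_prod_erase _ _ hmem]
    congr 1
    · simp [s]
    · have hmaps : ∀ p ∈ (Finset.univ.filter (fun p : Fin m × Fin m => p.1 < p.2)).erase (c, c'),
          (s p.1, s p.2) ∈
            (Finset.univ.filter (fun p : Fin m × Fin m => p.1 < p.2)).erase (c, c') := by
        intro p hp
        rw [Finset.mem_erase, Finset.mem_filter] at hp ⊢
        refine ⟨fun h => ?_, Finset.mem_univ _, swap_lt_swap hc hp.2.2 hp.1⟩
        have h1 : s p.1 = c := congrArg Prod.fst h
        have h2 : s p.2 = c' := congrArg Prod.snd h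
        rw [Equiv.swap_apply_eq_iff, Equiv.swap_apply_left] at h1
        rw [Equiv.swap_apply_eq_iff, Equiv.swap_apply_right] at h2
        exact absurd hp.2.2 (by rw [h1, h2]; exact hlt.not_gt)
      refine (Finset.prod_nbij' (fun p => (s p.1, s p.2)) (fun p => (s p.1, s p.2)) hmaps hmaps
        ?_ ?_ ?_).symm
      · intro p _; simp [s]
      · intro p _; simp [s]
      · intro p _; simp [s]

/-- Away from the simple pole at `t_c = t_{c'}`, the expansion of the poles of `R` is compatible
with the swap of `c` and `c'`. -/
theorem isPermuted_prod_inv [LinearOrder I] {c c' : Fin m} (hc : (c : ℕ) + 1 = c')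
    (ι : Fin m → I) :
    IsPermuted (Equiv.swap c c')
      ((tvar K c - tvar K c') * (∏ p ∈ Finset.univ.filter
        (fun p : Fin m × Fin m => ι p.1 < ι p.2), (tvar K p.1 - tvar K p.2))⁻¹)
      ((tvar K c' - tvar K c) * (∏ p ∈ Finset.univ.filter
        (fun p : Fin m × Fin m => ι p.1 < ι p.2),
          (tvar K (Equiv.swap c c' p.1) - tvar K (Equiv.swap c c' p.2)))⁻¹) := by
  set s := Equiv.swap c c' with hs
  set A := Finset.univ.filter (fun p : Fin m × Fin m => ι p.1 < ι p.2) with hA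
  have hlt : c < c' := by rw [Fin.lt_def]; omega
  have hsc : s c = c' := Equiv.swap_apply_left c c'
  have hsc' : s c' = c := Equiv.swap_apply_right c c'
  have hcc := (isPermuted_tvar_swap (K := K) c c' c).sub (isPermuted_tvar_swap c c' c')
  rw [← hs, hsc, hsc'] at hcc
  have hne : ∀ {a b : Fin m}, a < b → tvar K a - tvar K b ≠ 0 := fun h => by
    simpa using tvar_sub_ne_zero (K := K) h one_ne_zero
  have hgood : ∀ p : Fin m × Fin m, ι p.1 < ι p.2 → p ≠ (c, c') → p ≠ (c', c) →
      IsPermuted s ((tvar K p.1 - tvar K p.2)⁻¹) ((tvar K (s p.1) - tvar K (s p.2))⁻¹) := by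
    rintro ⟨a, b⟩ hι h1 h2
    rcases lt_trichotomy a b with h | h | h
    · simpa using isPermuted_inv_tvar_sub_swap (K := K) hc h h1 one_ne_zero
    · simp [h] at hι
    · have := (isPermuted_inv_tvar_sub_swap (K := K) hc h (fun h' => h2 (by
        rw [Prod.mk.injEq] at h' ⊢; exact ⟨h'.2, h'.1⟩)) one_ne_zero).neg
      simp only [map_one, one_mul] at this
      rwa [← inv_neg, ← inv_neg, neg_sub, neg_sub] at this
  -- At most one of `(c, c')`, `(c', c)` lies in `A`, as their colour conditions exclude each other.
  -- Its factor is cancelled, up to sign, by the prefactor.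
  have hbad : ∀ p : Fin m × Fin m, p ∈ A → (p = (c, c') ∨ p = (c', c)) → IsPermuted s
      ((tvar K c - tvar K c') * (∏ p ∈ A, (tvar K p.1 - tvar K p.2))⁻¹)
      ((tvar K c' - tvar K c) * (∏ p ∈ A, (tvar K (s p.1) - tvar K (s p.2)))⁻¹) := by
    intro p hp hpc
    rw [← Finset.mul_prod_erase A _ hp, ← Finset.mul_prod_erase A _ hp, mul_inv, mul_inv,
      ← mul_assoc, ← mul_assoc, ← Finset.prod_inv_distrib, ← Finset.prod_inv_distrib]
    refine IsPermuted.mul ?_ (isPermuted_prod s _ fun p' hp' => ?_)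
    · rcases hpc with rfl | rfl
      · rw [hsc, hsc', mul_inv_cancel₀ (hne hlt), mul_inv_cancel₀]
        · exact IsPermuted.one
        · rw [← neg_sub]
          exact neg_ne_zero.2 (hne hlt)
      · have hinv : (-(tvar K c - tvar K c'))⁻¹ = -(tvar K c - tvar K c')⁻¹ := inv_neg
        rw [hsc, hsc', ← neg_sub (tvar K c) (tvar K c'), hinv, mul_neg, neg_mul,
          mul_inv_cancel₀ (hne hlt)]
        exact IsPermuted.one.neg
    · rw [Finset.mem_erase] at hp'
      have hι' := (Finset.mem_filter.1 hp'.2).2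
      have hι := (Finset.mem_filter.1 hp).2
      refine hgood p' hι' ?_ ?_
      · rintro rfl
        rcases hpc with rfl | rfl
        · exact hp'.1 rfl
        · exact lt_asymm hι hι'
      · rintro rfl
        rcases hpc with rfl | rfl
        · exact lt_asymm hι hι'
        · exact hp'.1 rfl
  by_cases h1 : (c, c') ∈ A
  · exact hbad _ h1 (Or.inl rfl)
  by_cases h2 : (c', c) ∈ A
  · exact hbad _ h2 (Or.inr rfl)
  refine hcc.mul ?_
  rw [← Finset.prod_inv_distrib, ← Finset.prod_inv_distrib]
  refine isPermuted_prod s _ fun p hp => hgood p (Finset.mem_filter.1 hp).2 ?_ ?_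
  · rintro rfl
    exact h1 hp
  · rintro rfl
    exact h2 hp

theorem expand_pairProd [LinearOrder I] (ε : ℤˣ) (ι : Fin m → I) :
    expand K m ε (pairProd K ε ι) = ∏ p ∈ Finset.univ.filter
      (fun p : Fin m × Fin m => ι p.1 < ι p.2), (tvar K p.1 - tvar K p.2) := by
  rw [pairProd, map_prod]
  exact Finset.prod_congr rfl fun p _ => by rw [map_sub, expand_z_zpow, expand_z_zpow]

theorem pairCoeff_combination (ε : ℤˣ) (d : Matrix I I ℤ) (q : K) (ι : Fin m → I)
    (k : Fin m → ℤ) (F : RatFun K (Fin m)) (a b : Fin m) (x y : K) :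
    x * pairCoeff ε d q ι (k + Pi.single a 1) F - y * pairCoeff ε d q ι (k + Pi.single b 1) F =
      (mono K (-k) * ((HahnSeries.C x * (tvar K a)⁻¹ - HahnSeries.C y * (tvar K b)⁻¹) *
        (expand K m ε F * kernel d q ι))).coeff 0 := by
  rw [pairCoeff, pairCoeff, ← coeff_C_mul, ← coeff_C_mul, ← HahnSeries.coeff_sub]
  congr 1
  rw [neg_add, neg_add, mono_add, mono_add, mono_neg K (Pi.single a 1), mono_neg K (Pi.single b 1),
    ← tvar, ← tvar]
  ring

/-- This is the quadratic relation for constant terms. Both sides are the constant term of one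
rational expression, before and after the swap; all factors whose expansion depends on the order of
`t_c` and `t_{c'}` have cancelled. -/
theorem pairCoeff_swap [LinearOrder I] (ε : ℤˣ) {d : Matrix I I ℤ} (hd : ∀ i j, d i j = d j i)
    {q : K} (hq : q ≠ 0) {c c' : Fin m} (hc : (c : ℕ) + 1 = c') (ι : Fin m → I) (k : Fin m → ℤ)
    {F : RatFun K (Fin m)} (hF : F * pairProd K ε ι ∈ laurent K (Fin m)) :
    pairCoeff ε d q ι (k + Pi.single c 1) F -
        q ^ d (ι c) (ι c') * pairCoeff ε d q ι (k + Pi.single c' 1) F =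
      q ^ d (ι c) (ι c') * pairCoeff ε d q (ι ∘ Equiv.swap c c')
          ((k + Pi.single c 1) ∘ Equiv.swap c c') (relabel K (Equiv.swap c c') F) -
        pairCoeff ε d q (ι ∘ Equiv.swap c c')
          ((k + Pi.single c' 1) ∘ Equiv.swap c c') (relabel K (Equiv.swap c c') F) := by
  set s := Equiv.swap c c' with hs
  set Q := q ^ d (ι c) (ι c') with hQ
  have hQ0 : Q ≠ 0 := zpow_ne_zero _ hq
  have hsingle : ∀ a, (k + Pi.single a 1) ∘ s = k ∘ s + Pi.single (s a) 1 := by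
    intro a
    ext b
    simp [Pi.single_apply, s, Equiv.swap_apply_eq_iff]
  rw [hsingle, hsingle, Equiv.swap_apply_left, Equiv.swap_apply_right]
  have hl := pairCoeff_combination ε d q ι k F c c' 1 Q
  have hr := pairCoeff_combination ε d q (ι ∘ s) (k ∘ s) (relabel K s F) c' c Q 1
  rw [one_mul] at hl hr
  rw [hl, hr]
  obtain ⟨x, y, hxy, hx, hy⟩ := exists_kernel_eq hc d hq ι
  rw [← hs] at hxy hy
  rw [hx, hy, hd (ι c') (ι c)]
  have hqinv : q ^ (-d (ι c) (ι c')) = Q⁻¹ := zpow_neg _ _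
  rw [hqinv]
  obtain ⟨L, hL⟩ : ∃ L, L = F * pairProd K ε ι := ⟨_, rfl⟩
  rw [← hL] at hF
  have hFL : F = L * (pairProd K ε ι)⁻¹ := by
    rw [hL, mul_assoc, mul_inv_cancel₀ (pairProd_ne_zero K ε ι), mul_one]
  have hP : IsPermuted s
      ((tvar K c - tvar K c') * (expand K m ε (pairProd K ε ι))⁻¹)
      ((tvar K c' - tvar K c) * (expand K m ε (relabel K s (pairProd K ε ι)))⁻¹) := by
    have h := isPermuted_prod_inv (K := K) hc ι
    rw [← hs] at h
    have h1 : relabel K s (pairProd K ε ι) = pairProd K ε (fun a => ι (s a)) := by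
      rw [← relabel_pairProd K ε s (fun a => ι (s a))]
      simp [s]
    rw [expand_pairProd, h1, expand_pairProd]
    have h2 := prod_relabel_pairs s (fun a => ι (s a))
      (fun p : Fin m × Fin m => (tvar K p.1 - tvar K p.2))
    simp only [s, Equiv.swap_apply_self] at h2
    rw [← h2]
    exact h
  have hE := isPermuted_expand ε s hF
  have hs' : s.symm = s := Equiv.symm_swap c c'
  rw [hs'] at hE
  have hk := isPermuted_mono (K := K) s (-k)
  have hT := (isPermuted_tvar (K := K) s (-1) c).mul (isPermuted_tvar (K := K) s (-1) c')
  rw [hs', show s c = c' from Equiv.swap_apply_left c c',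
    show s c' = c from Equiv.swap_apply_right c c'] at hT
  -- The exponent `0` is fixed by the swap, so related series have equal constant terms.
  have htot := hk.mul ((((isPermuted_C s (-Q)).mul hT).mul (hE.mul hP)).mul hxy) 0
  have hc0 := tvar_ne_zero (K := K) c
  have hc0' := tvar_ne_zero (K := K) c'
  have hlt : c < c' := by rw [Fin.lt_def]; omega
  have hden := tvar_sub_ne_zero (K := K) hlt (inv_ne_zero hQ0)
  have hCQ : (HahnSeries.C Q⁻¹ : HahnSeries (Lex (Fin m → ℤ)) K) = (HahnSeries.C Q)⁻¹ :=
    map_inv₀ _ _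
  have hCQ0 : (HahnSeries.C Q : HahnSeries (Lex (Fin m → ℤ)) K) ≠ 0 := C_ne_zero hQ0
  rw [hCQ] at hden ⊢
  -- The coefficients of the relation combine to a monomial times the denominator of the kernel
  -- factor of `(c, c')`; in `e2` the same happens with the opposite sign.
  have e1 : (HahnSeries.C 1 * (tvar K c)⁻¹ - HahnSeries.C Q * (tvar K c')⁻¹) =
      HahnSeries.C (-Q) * (tvar K c ^ (-1 : ℤ) * tvar K c' ^ (-1 : ℤ)) *
        (tvar K c - (HahnSeries.C Q)⁻¹ * tvar K c') := by
    rw [map_neg, map_one, zpow_neg, zpow_neg, zpow_one, zpow_one]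
    field_simp
    ring
  have e2 : (HahnSeries.C Q * (tvar K c')⁻¹ - HahnSeries.C 1 * (tvar K c)⁻¹) =
      -(HahnSeries.C (-Q) * (tvar K c' ^ (-1 : ℤ) * tvar K c ^ (-1 : ℤ)) *
        (tvar K c - (HahnSeries.C Q)⁻¹ * tvar K c')) := by
    rw [map_neg, map_one, zpow_neg, zpow_neg, zpow_one, zpow_one]
    field_simp
  have hneg : -(k ∘ s) = (-k) ∘ s := rfl
  rw [e1, e2, hFL, map_mul, map_mul, map_mul, map_inv₀ (relabel K s), map_inv₀, map_inv₀, hneg]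
  clear hFL hL hl hr hx hy
  have hzero : (0 : Fin m → ℤ) ∘ s = 0 := rfl
  rw [hzero] at htot
  have cancel : ∀ {M A X P T D Y : HahnSeries (Lex (Fin m → ℤ)) K}, D ≠ 0 →
      M * (A * D * (X * P * (T * D⁻¹ * Y))) = M * (A * (X * (T * P)) * Y) := by
    intro M A X P T D Y hD
    field_simp
  have cancel_neg : ∀ {M A X P T D Y : HahnSeries (Lex (Fin m → ℤ)) K}, D ≠ 0 →
      M * (-(A * D) * (X * P * (T * D⁻¹ * Y))) = M * (A * (X * (-T * P)) * Y) := by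
    intro M A X P T D Y hD
    field_simp
  rw [cancel hden, cancel_neg hden, neg_sub]
  exact htot

end Kernel

/-! ### Linear forms on `V` defined by words -/

section WordForm

variable {K : Type*} [Field K] {m : ℕ} {I : Type*}

theorem pairCoeff_add (ε : ℤˣ) (d : Matrix I I ℤ) (q : K) (ι : Fin m → I) (k : Fin m → ℤ)
    (F G : RatFun K (Fin m)) :
    pairCoeff ε d q ι k (F + G) = pairCoeff ε d q ι k F + pairCoeff ε d q ι k G := by
  rw [pairCoeff, map_add, add_mul, mul_add, HahnSeries.coeff_add, pairCoeff, pairCoeff]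

theorem pairCoeff_smul (ε : ℤˣ) (d : Matrix I I ℤ) (q : K) (ι : Fin m → I) (k : Fin m → ℤ)
    (c : K) (F : RatFun K (Fin m)) :
    pairCoeff ε d q ι k (c • F) = c * pairCoeff ε d q ι k F := by
  rw [pairCoeff, Algebra.smul_def, map_mul, expand_algebraMap, mul_assoc, mul_left_comm,
    coeff_C_mul, pairCoeff]

variable [Fintype I] [LinearOrder I]

open Classical in
/-- The linear form on the component of degree `n` that is defined by a word. -/
noncomputable def compForm (ε : ℤˣ) (d : Matrix I I ℤ) (q : K) (ι : Fin m → I) (k : Fin m → ℤ)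
    (n : I → ℕ) : VComp K n →ₗ[K] K :=
  if h : ∃ β : Fin m ≃ Vars n, ∀ a, (β a).1 = ι a then
    { toFun := fun R => pairCoeff ε d q ι k (relabel K h.choose.symm (R : RatFun K (Vars n)))
      map_add' := fun R S => by rw [Submodule.coe_add, map_add, pairCoeff_add]
      map_smul' := fun c R => by
        rw [Submodule.coe_smul, map_smul, pairCoeff_smul, RingHom.id_apply, smul_eq_mul] }
  else 0

theorem compForm_apply (ε : ℤˣ) (d : Matrix I I ℤ) (q : K) {ι : Fin m → I} (k : Fin m → ℤ)
    {n : I → ℕ} (β : Fin m ≃ Vars n) (hβ : ∀ a, (β a).1 = ι a) (R : VComp K n) :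
    compForm ε d q ι k n R =
      pairCoeff ε d q ι k (relabel K β.symm (R : RatFun K (Vars n))) := by
  have h : ∃ β : Fin m ≃ Vars n, ∀ a, (β a).1 = ι a := ⟨β, hβ⟩
  rw [compForm, dif_pos h]
  change pairCoeff ε d q ι k (relabel K h.choose.symm (R : RatFun K (Vars n))) = _
  rw [relabel_symm_eq_of_mem_VComp R.2 h.choose β fun a => (h.choose_spec a).trans (hβ a).symm]

theorem compForm_eq_zero (ε : ℤˣ) (d : Matrix I I ℤ) (q : K) {ι : Fin m → I} (k : Fin m → ℤ)
    {n : I → ℕ} (h : ¬ ∃ β : Fin m ≃ Vars n, ∀ a, (β a).1 = ι a) :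
    compForm ε d q ι k n = 0 := by
  rw [compForm, dif_neg h]

/-- The linear form on `V` that is defined by a word. -/
noncomputable def wordForm (ε : ℤˣ) (d : Matrix I I ℤ) (q : K) (w : Fin m → I × ℤ) :
    V K I →ₗ[K] K :=
  DirectSum.toModule K (I → ℕ) K (compForm ε d q (fun a => (w a).1) fun a => (w a).2)

theorem wordForm_homog (ε : ℤˣ) (d : Matrix I I ℤ) (q : K) (w : Fin m → I × ℤ) (n : I → ℕ)
    (R : VComp K n) : wordForm ε d q w (homog K n R) =
      compForm ε d q (fun a => (w a).1) (fun a => (w a).2) n R := by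
  rw [wordForm, homog, ← DirectSum.lof_eq_of K, DirectSum.toModule_lof]

theorem wordForm_swap (ε : ℤˣ) {d : Matrix I I ℤ} (hd : ∀ i j, d i j = d j i) {q : K}
    (hq : q ≠ 0) {c c' : Fin m} (hc : (c : ℕ) + 1 = c') (ι : Fin m → I) (k : Fin m → ℤ) :
    wordForm ε d q (fun a => (ι a, k a + (Pi.single c 1 : Fin m → ℤ) a)) -
        q ^ d (ι c) (ι c') • wordForm ε d q (fun a => (ι a, k a + (Pi.single c' 1 : Fin m → ℤ) a)) =
      q ^ d (ι c) (ι c') • wordForm ε d q (fun a => (ι (Equiv.swap c c' a),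
          k (Equiv.swap c c' a) + (Pi.single c 1 : Fin m → ℤ) (Equiv.swap c c' a))) -
        wordForm ε d q (fun a => (ι (Equiv.swap c c' a),
          k (Equiv.swap c c' a) + (Pi.single c' 1 : Fin m → ℤ) (Equiv.swap c c' a))) := by
  refine DirectSum.linearMap_ext K fun n => LinearMap.ext fun R => ?_
  have hh : ∀ w : Fin m → I × ℤ, wordForm ε d q w (DirectSum.lof K (I → ℕ)
      (fun n => VComp K n) n R) = compForm ε d q (fun a => (w a).1) (fun a => (w a).2) n R :=
    fun w => wordForm_homog ε d q w n R
  simp only [LinearMap.comp_apply, LinearMap.sub_apply, LinearMap.smul_apply, hh, smul_eq_mul]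
  by_cases h : ∃ β : Fin m ≃ Vars n, ∀ a, (β a).1 = ι a
  · obtain ⟨β, hβ⟩ := h
    have hβ' : ∀ a, (((Equiv.swap c c').trans β) a).1 = ι (Equiv.swap c c' a) := fun a => hβ _
    rw [compForm_apply ε d q _ β hβ, compForm_apply ε d q _ β hβ,
      compForm_apply ε d q _ _ hβ', compForm_apply ε d q _ _ hβ']
    have hF : relabel K β.symm (R : RatFun K (Vars n)) * pairProd K ε ι ∈ laurent K (Fin m) := by
      have hp := relabel_pairProd K ε β.symm ι
      have hι : (fun s => ι (β.symm s)) = (Sigma.fst : Vars n → I) := by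
        funext s
        rw [← hβ, Equiv.apply_symm_apply]
      rw [hι] at hp
      rw [← hp, ← map_mul]
      exact relabel_mem_laurent K _ ((mem_VComp_iff ε).1 R.2).1
    have hr : relabel K ((Equiv.swap c c').trans β).symm (R : RatFun K (Vars n)) =
        relabel K (Equiv.swap c c') (relabel K β.symm (R : RatFun K (Vars n))) := by
      rw [relabel_relabel]
      rfl
    rw [hr]
    exact pairCoeff_swap ε hd hq hc ι k hF
  · have h' : ¬ ∃ β : Fin m ≃ Vars n, ∀ a, (β a).1 = ι (Equiv.swap c c' a) := by
      rintro ⟨β, hβ⟩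
      exact h ⟨(Equiv.swap c c').trans β, fun a => by simp [hβ]⟩
    rw [compForm_eq_zero ε d q _ h, compForm_eq_zero ε d q _ h, compForm_eq_zero ε d q _ h',
      compForm_eq_zero ε d q _ h']
    simp

theorem wordForm_get_ofFn (ε : ℤˣ) (d : Matrix I I ℤ) (q : K) (w : Fin m → I × ℤ)
    {l : List (I × ℤ)} (h : l = List.ofFn w) : wordForm ε d q l.get = wordForm ε d q w := by
  subst h
  have key : ∀ {m' : ℕ} (w' : Fin m' → I × ℤ) (hm : m' = m),
      (∀ a, w' a = w (Fin.cast hm a)) → wordForm ε d q w' = wordForm ε d q w := by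
    rintro m' w' rfl h
    rw [funext h]
    rfl
  exact key _ (List.length_ofFn) fun a => by
    simp only [List.get_ofFn]

theorem quadRelFun_wordForm (ε : ℤˣ) {d : Matrix I I ℤ} (hd : ∀ i j, d i j = d j i) {q : K}
    (hq : q ≠ 0) : QuadRelFun d q fun l : List (I × ℤ) => wordForm ε d q l.get := by
  intro u v i j k l
  set w := u ++ (i, k) :: (j, l) :: v with hw
  have hlen : w.length = u.length + (v.length + 1 + 1) := by simp [hw]
  let c : Fin w.length := ⟨u.length, by omega⟩
  let c' : Fin w.length := ⟨u.length + 1, by omega⟩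
  have h := wordForm_swap ε hd hq (c := c) (c' := c') rfl
    (fun a => (w.get a).1) (fun a => (w.get a).2)
  have hwc : w.get c = (i, k) := by simp [hw, c]
  have hwc' : w.get c' = (j, l) := by simp [hw, c']
  have hsplit : ∀ (x y : I × ℤ) (f : Fin w.length → I × ℤ), f c = x → f c' = y →
      (∀ a, a ≠ c → a ≠ c' → f a = w.get a) → u ++ x :: y :: v = List.ofFn f := by
    intro x y f hx hy hf
    refine List.ext_getElem (by simp [hw]; omega) fun n h1 h2 => ?_
    rw [List.getElem_ofFn]
    have hn : n < w.length := by simpa using h2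
    by_cases hnc : n = u.length
    · subst hnc
      simpa using hx.symm
    by_cases hnc' : n = u.length + 1
    · subst hnc'
      simpa using hy.symm
    rw [hf _ (by simpa [c, Fin.ext_iff] using hnc) (by simpa [c', Fin.ext_iff] using hnc')]
    simp only [hw, List.get_eq_getElem, List.getElem_append, List.getElem_cons]
    split_ifs <;> first | rfl | omega
  have hcc' : c ≠ c' := by simp [c, c', Fin.ext_iff]
  rw [hwc, hwc'] at h
  beta_reduce
  rw [wordForm_get_ofFn ε d q _ (hsplit (i, k + 1) (j, l) _ ?_ ?_ ?_),
    wordForm_get_ofFn ε d q _ (hsplit (i, k) (j, l + 1) _ ?_ ?_ ?_),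
    wordForm_get_ofFn ε d q _ (hsplit (j, l) (i, k + 1) _ ?_ ?_ ?_),
    wordForm_get_ofFn ε d q _ (hsplit (j, l + 1) (i, k) _ ?_ ?_ ?_)]
  · exact h
  all_goals first
    | (intro a ha ha'; simp [Equiv.swap_apply_of_ne_of_ne ha ha', ha, ha'])
    | simp [hwc, hwc', hcc', hcc'.symm, -List.get_eq_getElem]

end WordForm

theorem IsQuadPresentation.ext {K : Type*} [Field K] {I : Type*} {A : Type*} [Ring A]
    [Algebra K A] {d : Matrix I I ℤ} {q : K} {g : I × ℤ → A}
    (hg : IsQuadPresentation d q g) {P : Type*} [AddCommGroup P] [Module K P] {φ ψ : A →ₗ[K] P}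
    (h : ∀ w : List (I × ℤ), φ (w.map g).prod = ψ (w.map g).prod) : φ = ψ := by
  refine LinearMap.ext fun a => ?_
  refine LinearMap.eqOn_span (s := Set.range fun w : List (I × ℤ) => (w.map g).prod) ?_ (hg.span a)
  rintro _ ⟨w, rfl⟩
  exact h w

/-! ### Existence and uniqueness of the common pairing -/

section PairForm

variable {K : Type*} [Field K] {I : Type*} [Fintype I] [LinearOrder I]
  {A : Type*} [Ring A] [Algebra K A]

/-- The common form of the two pairings, for an algebra with generators `g (i, k)`. -/
def IsPairForm (ε : ℤˣ) (d : Matrix I I ℤ) (q : K) (g : I × ℤ → A)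
    (B : A →ₗ[K] V K I →ₗ[K] K) : Prop :=
  ∀ (m : ℕ) (ι : Fin m → I) (k : Fin m → ℤ) (n : I → ℕ) (R : VComp K n),
    (∀ β : Fin m ≃ Vars n, (∀ a, (β a).1 = ι a) →
      B (List.ofFn fun a => g (ι a, k a)).prod (homog K n R) =
        pairCoeff ε d q ι k (relabel K β.symm (R : RatFun K (Vars n)))) ∧
    (n ≠ ∑ a : Fin m, Pi.single (ι a) 1 →
      B (List.ofFn fun a => g (ι a, k a)).prod (homog K n R) = 0)

theorem isPairForm_iff {ε : ℤˣ} {d : Matrix I I ℤ} {q : K} {g : I × ℤ → A}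
    {B : A →ₗ[K] V K I →ₗ[K] K} :
    IsPairForm ε d q g B ↔
      ∀ w : List (I × ℤ), B (w.map g).prod = wordForm ε d q w.get := by
  constructor
  · intro h w
    refine DirectSum.linearMap_ext K fun n => LinearMap.ext fun R => ?_
    obtain ⟨h1, h2⟩ := h w.length (fun a => (w.get a).1) (fun a => (w.get a).2) n R
    have hw : (List.ofFn fun a => g ((w.get a).1, (w.get a).2)) = w.map g := by
      conv_rhs => rw [← List.ofFn_get w, List.map_ofFn]
      rfl
    rw [hw] at h1 h2
    change B (w.map g).prod (homog K n R) = wordForm ε d q w.get (homog K n R)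
    rw [wordForm_homog]
    by_cases hβ : ∃ β : Fin w.length ≃ Vars n, ∀ a, (β a).1 = (w.get a).1
    · obtain ⟨β, hβ⟩ := hβ
      rw [h1 β hβ, compForm_apply ε d q _ β hβ]
    · rw [compForm_eq_zero ε d q _ hβ, h2 fun hn => hβ (exists_equiv_of_content_eq hn)]
      rfl
  · intro h m ι k n R
    have hw : (List.ofFn fun a => g (ι a, k a)) = (List.ofFn fun a => (ι a, k a)).map g := by
      rw [List.map_ofFn]
      rfl
    rw [hw, h, wordForm_get_ofFn ε d q _ rfl, wordForm_homog]
    refine ⟨fun β hβ => compForm_apply ε d q k β hβ R, fun hn => ?_⟩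
    rw [compForm_eq_zero ε d q k fun ⟨β, hβ⟩ => hn (content_eq β hβ)]
    rfl

theorem existsUnique_isPairForm (ε : ℤˣ) {d : Matrix I I ℤ} (hd : ∀ i j, d i j = d j i) {q : K}
    (hq : q ≠ 0) {g : I × ℤ → A} (hg : IsQuadPresentation d q g) :
    ∃! B : A →ₗ[K] V K I →ₗ[K] K, IsPairForm ε d q g B := by
  have hlift : ∀ y : V K I, ∃ ψ : A →ₗ[K] K, ∀ w : List (I × ℤ),
      ψ (w.map g).prod = wordForm ε d q w.get y := by
    intro y
    refine hg.lift fun u v i j k l => ?_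
    have h := congrArg (fun φ : V K I →ₗ[K] K => φ y) (quadRelFun_wordForm ε hd hq u v i j k l)
    simpa using h
  -- The forms are chosen separately for each `y`. Linearity in `y` follows because a form on `A` is
  -- determined by its values on words.
  choose ψ hψ using hlift
  have hadd : ∀ y y', ψ (y + y') = ψ y + ψ y' := fun y y' => hg.ext fun w => by simp [hψ]
  have hsmul : ∀ (c : K) y, ψ (c • y) = c • ψ y := fun c y => hg.ext fun w => by simp [hψ]
  refine ⟨(LinearMap.mk₂ K (fun y a => ψ y a) (fun y y' a => by simp [hadd])
    (fun c y a => by simp [hsmul]) (fun y a a' => map_add _ _ _)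
    (fun c y a => map_smul _ _ _)).flip, isPairForm_iff.2 fun w => ?_, fun B' hB' => ?_⟩
  · ext1
    exact LinearMap.ext fun y => hψ _ w
  · refine hg.ext fun w => ?_
    rw [isPairForm_iff.1 hB' w]
    refine LinearMap.ext fun y => ?_
    exact (hψ y w).symm

end PairForm

/-! ### Leading exponents of the kernels -/

section LeadingTerms

variable {K : Type*} [Field K] {m : ℕ} {I : Type*}

/-- The Hahn series `x` is nonzero and its smallest exponent is `v`. -/
def HasLead (x : HahnSeries (Lex (Fin m → ℤ)) K) (v : Fin m → ℤ) : Prop :=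
  x ≠ 0 ∧ x.order = toLex v

theorem HasLead.mul {x y : HahnSeries (Lex (Fin m → ℤ)) K} {u v : Fin m → ℤ} (hx : HasLead x u)
    (hy : HasLead y v) : HasLead (x * y) (u + v) :=
  ⟨mul_ne_zero hx.1 hy.1, by rw [HahnSeries.order_mul hx.1 hy.1, hx.2, hy.2]; rfl⟩

theorem HasLead.inv {x : HahnSeries (Lex (Fin m → ℤ)) K} {u : Fin m → ℤ} (hx : HasLead x u) :
    HasLead x⁻¹ (-u) := by
  have hx' : x⁻¹ ≠ 0 := inv_ne_zero hx.1
  refine ⟨hx', ?_⟩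
  have h := HahnSeries.order_mul hx.1 hx'
  rw [mul_inv_cancel₀ hx.1, HahnSeries.order_one, hx.2] at h
  exact (neg_eq_of_add_eq_zero_right h.symm).symm

theorem hasLead_prod {α : Type*} (s : Finset α) {x : α → HahnSeries (Lex (Fin m → ℤ)) K}
    {v : α → Fin m → ℤ} (h : ∀ a ∈ s, HasLead (x a) (v a)) :
    HasLead (∏ a ∈ s, x a) (∑ a ∈ s, v a) := by
  classical
  induction s using Finset.induction_on with
  | empty => exact ⟨one_ne_zero, HahnSeries.order_one⟩
  | insert a s ha ih =>
    rw [Finset.prod_insert ha, Finset.sum_insert ha]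
    exact (h a (Finset.mem_insert_self a s)).mul
      (ih fun b hb => h b (Finset.mem_insert_of_mem hb))

theorem hasLead_tvar_sub {a b : Fin m} (h : a < b) {c : K} (hc : c ≠ 0) :
    HasLead (tvar K a - HahnSeries.C c * tvar K b) (Pi.single b 1) := by
  have hne := tvar_sub_ne_zero (K := K) h hc
  refine ⟨hne, ?_⟩
  have hb : HahnSeries.C c * tvar K b = HahnSeries.single (toLex (Pi.single b 1 : Fin m → ℤ)) c := by
    rw [tvar, mono, HahnSeries.C_apply, HahnSeries.single_mul_single, zero_add, mul_one]
  have hlt : (HahnSeries.C c * tvar K b).orderTop < (tvar K a).orderTop := by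
    rw [hb, HahnSeries.orderTop_single hc, tvar, mono, HahnSeries.orderTop_single one_ne_zero,
      WithTop.coe_lt_coe]
    exact toLex_single_lt h
  have h1 := HahnSeries.orderTop_sub hlt
  rw [hb, HahnSeries.orderTop_single hc, ← hb, ← HahnSeries.orderTop_neg, neg_sub] at h1
  rw [← WithTop.coe_inj, HahnSeries.order_eq_orderTop_of_ne_zero hne, h1]

/-- For `a < b` the exponent of `t_b` is smaller than that of `t_a`, so numerator and denominator of
each factor both lead with `t_b`, and these cancel. -/
theorem hasLead_kernel (d : Matrix I I ℤ) {q : K} (hq : q ≠ 0) (ι : Fin m → I) :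
    HasLead (kernel d q ι) 0 := by
  have h := hasLead_prod (K := K) (Finset.univ.filter (fun p : Fin m × Fin m => p.1 < p.2))
    (x := fun p => (tvar K p.1 - tvar K p.2) *
      (tvar K p.1 - HahnSeries.C (q ^ (-d (ι p.1) (ι p.2))) * tvar K p.2)⁻¹)
    (v := fun p => Pi.single p.2 1 + -Pi.single p.2 1) (fun p hp => by
      have hlt := (Finset.mem_filter.1 hp).2
      refine HasLead.mul ?_ (hasLead_tvar_sub hlt (zpow_ne_zero _ hq)).inv
      simpa using hasLead_tvar_sub (K := K) hlt one_ne_zero)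
  simpa [kernel] using h

/-- Each earlier letter of another colour forms with `b` exactly one pair ordered by colour, and the
later position of that pair is `b`. -/
theorem sum_single_max [LinearOrder I] (ι : Fin m → I) :
    ∑ p ∈ Finset.univ.filter (fun p : Fin m × Fin m => ι p.1 < ι p.2),
      (Pi.single (max p.1 p.2) 1 : Fin m → ℤ) = fun b => (diffBefore ι b : ℤ) := by
  funext b
  rw [Finset.sum_apply]
  simp only [Pi.single_apply]
  rw [← Finset.sum_filter, Finset.sum_const, nsmul_eq_mul, mul_one, diffBefore, Nat.cast_inj]
  refine Finset.card_bij' (fun p _ => min p.1 p.2)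
    (fun a _ => if ι a < ι b then (a, b) else (b, a)) ?_ ?_ ?_ ?_
  · rintro ⟨x, y⟩ hp
    simp only [Finset.mem_filter, Finset.mem_univ, true_and] at hp ⊢
    obtain ⟨hι, rfl⟩ := hp
    rcases lt_trichotomy x y with h | h | h
    · simp [h, h.le, hι.ne]
    · simp [h] at hι
    · simp [h, h.le, hι.ne']
  · intro a ha
    simp only [Finset.mem_filter, Finset.mem_univ, true_and] at ha ⊢
    split_ifs with h
    · simp [h, ha.1.le]
    · simp [lt_of_le_of_ne (not_lt.1 h) (Ne.symm ha.2), ha.1.le]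
  · rintro ⟨x, y⟩ hp
    simp only [Finset.mem_filter, Finset.mem_univ, true_and] at hp ⊢
    obtain ⟨hι, rfl⟩ := hp
    rcases lt_trichotomy x y with h | h | h
    · simp [h.le, hι]
    · simp [h] at hι
    · simp [h.le, hι.not_gt]
  · intro a ha
    simp only [Finset.mem_filter, Finset.mem_univ, true_and] at ha ⊢
    split_ifs <;> simp [ha.1.le]

theorem hasLead_prod_pairs [LinearOrder I] (ι : Fin m → I) :
    HasLead (∏ p ∈ Finset.univ.filter (fun p : Fin m × Fin m => ι p.1 < ι p.2),
      (tvar K p.1 - tvar K p.2)) (fun b => (diffBefore ι b : ℤ)) := by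
  rw [← sum_single_max]
  refine hasLead_prod _ fun p hp => ?_
  have hι := (Finset.mem_filter.1 hp).2
  rcases lt_trichotomy p.1 p.2 with h | h | h
  · rw [max_eq_right h.le]
    simpa using hasLead_tvar_sub (K := K) h one_ne_zero
  · simp [h] at hι
  · rw [max_eq_left h.le]
    have h1 := hasLead_tvar_sub (K := K) h one_ne_zero
    rw [map_one, one_mul] at h1
    rw [← neg_sub]
    exact ⟨neg_ne_zero.2 h1.1, by rw [HahnSeries.order_neg, h1.2]⟩

/-- The kernel of the pairing together with the poles of the elements of `V`. -/
noncomputable def fullKernel [LinearOrder I] (d : Matrix I I ℤ) (q : K) (ι : Fin m → I) :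
    HahnSeries (Lex (Fin m → ℤ)) K :=
  (∏ p ∈ Finset.univ.filter (fun p : Fin m × Fin m => ι p.1 < ι p.2),
    (tvar K p.1 - tvar K p.2))⁻¹ * kernel d q ι

theorem hasLead_fullKernel [LinearOrder I] (d : Matrix I I ℤ) {q : K} (hq : q ≠ 0)
    (ι : Fin m → I) : HasLead (fullKernel d q ι) (-fun b => (diffBefore ι b : ℤ)) := by
  have h := (hasLead_prod_pairs (K := K) ι).inv.mul (hasLead_kernel d hq ι)
  rwa [add_zero] at h

/-- Since `k - leadExp ι k` is the leading exponent of the full kernel, a larger `p` asks for a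
coefficient below the leading one. -/
theorem coeff_fullKernel_eq_zero [LinearOrder I] (d : Matrix I I ℤ) {q : K} (hq : q ≠ 0)
    (ι : Fin m → I) (k p : Fin m → ℤ) (h : ¬ toLex p ≤ toLex (leadExp ι k)) :
    (fullKernel d q ι).coeff (toLex (k - p)) = 0 := by
  apply HahnSeries.coeff_eq_zero_of_lt_order
  rw [(hasLead_fullKernel d hq ι).2]
  rw [not_le] at h
  have h1 := sub_lt_sub_left h (toLex k)
  have h2 : k - leadExp ι k = -fun b => (diffBefore ι b : ℤ) := by
    funext b
    simp [leadExp]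
  rw [← h2]
  exact h1

theorem coeff_fullKernel_ne_zero [LinearOrder I] (d : Matrix I I ℤ) {q : K} (hq : q ≠ 0)
    (ι : Fin m → I) (k : Fin m → ℤ) :
    (fullKernel d q ι).coeff (toLex (k - leadExp ι k)) ≠ 0 := by
  have h2 : k - leadExp ι k = -fun b => (diffBefore ι b : ℤ) := by
    funext b
    simp [leadExp]
  rw [h2, ← (hasLead_fullKernel d hq ι).2, Ne, HahnSeries.coeff_order_eq_zero]
  exact (hasLead_fullKernel d hq ι).1

end LeadingTerms

/-! ### Dual elements and triangularity -/

section DualElements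

variable (K : Type*) [Field K] {I : Type*} [Fintype I] [LinearOrder I]

/-- The monomial symmetric Laurent polynomial in the `z_s^ε` with exponents `μ`. -/
noncomputable def symMono (ε : ℤˣ) {n : I → ℕ} (μ : Vars n → ℤ) : RatFun K (Vars n) :=
  ∑ π : (∀ i, Equiv.Perm (Fin (n i))), ∏ s : Vars n,
    z K (Equiv.sigmaCongrRight π s) ^ ((ε : ℤ) * μ s)

theorem symMono_mem_symLaurent (ε : ℤˣ) {n : I → ℕ} (μ : Vars n → ℤ) :
    symMono K ε μ ∈ symLaurent K n := by
  refine ⟨sum_mem fun π _ => prod_mem fun s _ => z_zpow_mem_laurent K _ _, fun π' => ?_⟩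
  rw [symMono, map_sum]
  refine Fintype.sum_equiv (Equiv.mulLeft π') _ _ fun π => ?_
  rw [map_prod]
  refine Finset.prod_congr rfl fun s _ => ?_
  rw [map_zpow₀, relabel_z]
  rfl

/-- The element of `V` that is dual to a sorted word with leading exponents `μ`. -/
noncomputable def dualElt (ε : ℤˣ) {n : I → ℕ} (μ : Vars n → ℤ) : VComp K n :=
  ⟨symMono K ε μ * (pairProd K ε (Sigma.fst : Vars n → I))⁻¹, (mem_VComp_iff ε).2 (by
    rw [mul_assoc, inv_mul_cancel₀ (pairProd_ne_zero K ε _), mul_one]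
    exact symMono_mem_symLaurent K ε μ)⟩

variable {K}

/-- The denominator of the dual element is absorbed into the full kernel, and each monomial of the
symmetrization only shifts the coefficient that is read off. -/
theorem pairCoeff_dualElt (ε : ℤˣ) (d : Matrix I I ℤ) (q : K) {m : ℕ} {ι : Fin m → I}
    (k : Fin m → ℤ) {n : I → ℕ} (μ : Vars n → ℤ) (β : Fin m ≃ Vars n)
    (hβ : ∀ a, (β a).1 = ι a) :
    pairCoeff ε d q ι k (relabel K β.symm (dualElt K ε μ : RatFun K (Vars n))) =
      ∑ π : (∀ i, Equiv.Perm (Fin (n i))), (fullKernel d q ι).coeff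
        (toLex (k - fun a => μ ((Equiv.sigmaCongrRight π).symm (β a)))) := by
  have hp : relabel K β.symm (pairProd K ε (Sigma.fst : Vars n → I)) = pairProd K ε ι := by
    have hp := relabel_pairProd K ε β.symm ι
    have hι : (fun s => ι (β.symm s)) = (Sigma.fst : Vars n → I) := by
      funext s
      rw [← hβ, Equiv.apply_symm_apply]
    rwa [hι] at hp
  have hs : expand K m ε (relabel K β.symm (symMono K ε μ)) =
      ∑ π : (∀ i, Equiv.Perm (Fin (n i))),
        mono K fun a => μ ((Equiv.sigmaCongrRight π).symm (β a)) := by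
    rw [symMono, map_sum, map_sum]
    refine Finset.sum_congr rfl fun π _ => ?_
    rw [map_prod, map_prod, mono_eq_prod]
    refine Fintype.prod_equiv ((Equiv.sigmaCongrRight π).trans β.symm) _ _ fun s => ?_
    rw [map_zpow₀, relabel_z, expand_z_zpow_eq, ← mul_assoc]
    simp only [Equiv.trans_apply, Equiv.apply_symm_apply, Equiv.symm_apply_apply]
    congr 1
    rcases Int.units_eq_one_or ε with rfl | rfl <;> simp
  rw [pairCoeff, dualElt, map_mul, map_mul, map_inv₀, map_inv₀, hp, hs, expand_pairProd, mul_assoc,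
    ← fullKernel, Finset.sum_mul, Finset.mul_sum, HahnSeries.coeff_sum]
  refine Finset.sum_congr rfl fun π _ => ?_
  rw [← mul_assoc, ← mono_add, ← toLex_zero, coeff_mono_mul]
  congr 2
  abel

theorem shiftedLetter_le_of_pairCoeff_ne_zero (ε : ℤˣ) (d : Matrix I I ℤ) {q : K} (hq : q ≠ 0)
    {m : ℕ} {ι ι₀ : Fin m → I} {k k₀ : Fin m → ℤ}
    (hs₀ : StrictMono (shiftedLetter ι₀ k₀)) {n : I → ℕ} (β β₀ : Fin m ≃ Vars n)
    (hβ : ∀ a, (β a).1 = ι a) (hβ₀ : ∀ a, (β₀ a).1 = ι₀ a)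
    (h : pairCoeff ε d q ι k (relabel K β.symm
      (dualElt K ε (fun s => leadExp ι₀ k₀ (β₀.symm s)) : RatFun K (Vars n))) ≠ 0) :
    toLex (shiftedLetter ι₀ k₀) ≤ toLex (shiftedLetter ι k) := by
  rw [pairCoeff_dualElt ε d q k _ β hβ] at h
  obtain ⟨π, _, hπ⟩ := Finset.exists_ne_zero_of_sum_ne_zero h
  have hle : toLex (fun a => leadExp ι₀ k₀ (β₀.symm ((Equiv.sigmaCongrRight π).symm (β a)))) ≤
      toLex (leadExp ι k) := by
    by_contra hcon
    exact hπ (coeff_fullKernel_eq_zero d hq ι k _ hcon)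
  refine shiftedLetter_le hs₀ ((β.trans (Equiv.sigmaCongrRight π).symm).trans β₀.symm)
    (fun a => ?_) hle
  rw [← hβ₀, ← hβ]
  simp

/-- Every surviving permutation contributes the same leading coefficient. The identity survives, so
the total is a positive integer multiple of it. -/
theorem pairCoeff_dualElt_ne_zero [CharZero K] (ε : ℤˣ) (d : Matrix I I ℤ) {q : K} (hq : q ≠ 0)
    {m : ℕ} {ι : Fin m → I} {k : Fin m → ℤ} (hs : StrictMono (shiftedLetter ι k)) {n : I → ℕ}
    (β : Fin m ≃ Vars n) (hβ : ∀ a, (β a).1 = ι a) :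
    pairCoeff ε d q ι k (relabel K β.symm
      (dualElt K ε (fun s => leadExp ι k (β.symm s)) : RatFun K (Vars n))) ≠ 0 := by
  classical
  rw [pairCoeff_dualElt ε d q k _ β hβ]
  have hterm : ∀ π : (∀ i, Equiv.Perm (Fin (n i))), (fullKernel d q ι).coeff
      (toLex (k - fun a => leadExp ι k (β.symm ((Equiv.sigmaCongrRight π).symm (β a))))) =
      if (fun a => leadExp ι k (β.symm ((Equiv.sigmaCongrRight π).symm (β a)))) = leadExp ι k then
        (fullKernel d q ι).coeff (toLex (k - leadExp ι k)) else 0 := by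
    intro π
    split_ifs with h
    · rw [h]
    · refine coeff_fullKernel_eq_zero d hq ι k _ fun hle => h (funext fun a => ?_)
      refine leadExp_comp_eq hs ((β.trans (Equiv.sigmaCongrRight π).symm).trans β.symm)
        (fun a => ?_) hle a
      rw [← hβ, ← hβ]
      simp
  rw [Finset.sum_congr rfl fun π _ => hterm π, ← Finset.sum_filter, Finset.sum_const, nsmul_eq_mul]
  refine mul_ne_zero ?_ (coeff_fullKernel_ne_zero d hq ι k)
  rw [Nat.cast_ne_zero]
  refine Finset.card_ne_zero_of_mem (a := 1) ?_
  rw [Finset.mem_filter]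
  refine ⟨Finset.mem_univ _, funext fun a => ?_⟩
  have h1 : (Equiv.sigmaCongrRight (1 : ∀ i, Equiv.Perm (Fin (n i)))).symm (β a) = β a := rfl
  rw [h1, Equiv.symm_apply_apply]

end DualElements

/-! ### Non-degeneracy -/

section Nondegeneracy

variable {K : Type*} [Field K] {I : Type*} [Fintype I] [LinearOrder I]
  {A : Type*} [Ring A] [Algebra K A]

theorem wordForm_apply (ε : ℤˣ) (d : Matrix I I ℤ) (q : K) {m : ℕ} (w : Fin m → I × ℤ)
    {n : I → ℕ} (β : Fin m ≃ Vars n) (hβ : ∀ a, (β a).1 = (w a).1) (y : V K I) :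
    wordForm ε d q w y = compForm ε d q (fun a => (w a).1) (fun a => (w a).2) n (y n) := by
  have h : wordForm ε d q w = (compForm ε d q (fun a => (w a).1) (fun a => (w a).2) n).comp
      (DirectSum.component K (I → ℕ) (fun n => VComp K n) n) := by
    refine DirectSum.linearMap_ext K fun n' => LinearMap.ext fun R => ?_
    change wordForm ε d q w (homog K n' R) = _
    rw [wordForm_homog, LinearMap.comp_apply, LinearMap.comp_apply]
    by_cases hn : n' = n
    · subst hn
      rw [DirectSum.component.lof_self]
    · rw [DirectSum.component.of, dif_neg hn, map_zero, compForm_eq_zero]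
      · rfl
      · rintro ⟨β', hβ'⟩
        exact hn ((content_eq β' hβ').trans (content_eq β hβ).symm)
  rw [h]
  rfl

/-- For each degree one arrangement of the colours suffices: varying the exponents detects every
coefficient of a product in a field, one factor of which is the nonzero kernel. -/
theorem separatingRight_of_isPairForm {ε : ℤˣ} {d : Matrix I I ℤ} {q : K} (hq : q ≠ 0)
    {g : I × ℤ → A} {B : A →ₗ[K] V K I →ₗ[K] K} (hB : IsPairForm ε d q g B) :
    B.SeparatingRight := by
  intro y hy
  refine DFinsupp.ext fun n => ?_
  let β : Fin (Fintype.card (Vars n)) ≃ Vars n := (Fintype.equivFin _).symm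
  have hk : ∀ k, pairCoeff ε d q (fun a => (β a).1) k
      (relabel K β.symm (y n : RatFun K (Vars n))) = 0 := by
    intro k
    have h := hy ((List.ofFn fun a => ((β a).1, k a)).map g).prod
    rw [isPairForm_iff.1 hB, wordForm_get_ofFn ε d q _ rfl,
      wordForm_apply ε d q _ β (fun _ => rfl), compForm_apply ε d q _ β (fun _ => rfl)] at h
    exact h
  have h0 : expand K _ ε (relabel K β.symm (y n : RatFun K (Vars n))) *
      kernel d q (fun a => (β a).1) = 0 := by
    ext v
    have h := hk (ofLex v)
    rw [pairCoeff, ← toLex_zero, coeff_mono_mul, zero_sub, neg_neg] at h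
    exact h
  rcases mul_eq_zero.1 h0 with h | h
  · rw [map_eq_zero, EmbeddingLike.map_eq_zero_iff] at h
    exact Subtype.ext h
  · exact absurd h (hasLead_kernel d hq _).1

theorem separatingLeft_of_isPairForm [CharZero K] {ε : ℤˣ} {d : Matrix I I ℤ} {q : K} (hq : q ≠ 0)
    {g : I × ℤ → A} (hg : IsQuadPresentation d q g) {B : A →ₗ[K] V K I →ₗ[K] K}
    (hB : IsPairForm ε d q g B) : B.SeparatingLeft := by
  classical
  intro a ha
  obtain ⟨c, hc, rfl⟩ := (Finsupp.mem_span_image_iff_linearCombination K).1 (hg.mem_span_sorted a)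
  rw [Finsupp.mem_supported] at hc
  by_contra hne
  have hc0 : c ≠ 0 := by
    rintro rfl
    exact hne (map_zero _)
  obtain ⟨w₁, hw₁⟩ := Finsupp.support_nonempty_iff.2 hc0
  obtain ⟨m, hm⟩ : ∃ m, w₁.length = m := ⟨_, rfl⟩
  have hofFn : ∀ w : List (I × ℤ), w.length = m → ∃ f : Fin m → I × ℤ, List.ofFn f = w := by
    rintro w rfl
    exact ⟨w.get, List.ofFn_get w⟩
  obtain ⟨f₁, rfl⟩ := hofFn w₁ hm
  let n : I → ℕ := ∑ a, Pi.single (f₁ a).1 1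
  -- Words of other degrees pair to zero with `V_n`, so only the words of one degree in the support
  -- compete.
  let T : Finset (Fin m → I × ℤ) := (c.support.preimage List.ofFn
    (List.ofFn_injective.injOn)).filter fun f => n = ∑ a, Pi.single (f a).1 1
  have hT : ∀ f, f ∈ T ↔ List.ofFn f ∈ c.support ∧ n = ∑ a, Pi.single (f a).1 1 := by
    intro f
    simp only [T, Finset.mem_filter, Finset.mem_preimage]
  -- The dual element of `f₀` can pair nontrivially only with words at least as large as `f₀`.
  -- Maximality therefore isolates the coefficient of `f₀`.
  obtain ⟨f₀, hf₀, hmax⟩ := T.exists_max_image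
    (fun f => toLex (shiftedLetter (fun a => (f a).1) fun a => (f a).2))
    ⟨f₁, (hT f₁).2 ⟨hw₁, rfl⟩⟩
  rw [hT] at hf₀
  have hs₀ : StrictMono (shiftedLetter (fun a => (f₀ a).1) fun a => (f₀ a).2) :=
    strictMono_shiftedLetter (hc hf₀.1)
  obtain ⟨β₀, hβ₀⟩ := exists_equiv_of_content_eq hf₀.2
  let R := dualElt K ε (fun s => leadExp (fun a => (f₀ a).1) (fun a => (f₀ a).2) (β₀.symm s))
  have h := ha (homog K n R)
  rw [Finsupp.linearCombination_apply, Finsupp.sum, map_sum, LinearMap.sum_apply] at h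
  simp only [map_smul, LinearMap.smul_apply, isPairForm_iff.1 hB] at h
  rw [Finset.sum_eq_single (List.ofFn f₀)] at h
  · rw [wordForm_get_ofFn ε d q _ rfl, wordForm_homog, compForm_apply ε d q _ β₀ hβ₀, smul_eq_mul]
      at h
    exact mul_ne_zero (Finsupp.mem_support_iff.1 hf₀.1)
      (pairCoeff_dualElt_ne_zero ε d hq hs₀ β₀ hβ₀) h
  · intro w hw hwne
    rw [wordForm_homog, smul_eq_zero]
    right
    by_cases hβ : ∃ β : Fin w.length ≃ Vars n, ∀ a, (β a).1 = (w.get a).1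
    · have hlen : w.length = m := by
        obtain ⟨β, -⟩ := hβ
        simpa using Fintype.card_congr (β.trans β₀.symm)
      obtain ⟨f, rfl⟩ := hofFn w hlen
      rw [← wordForm_homog, wordForm_get_ofFn ε d q _ rfl, wordForm_homog]
      by_cases hβ' : ∃ β : Fin m ≃ Vars n, ∀ a, (β a).1 = (f a).1
      · obtain ⟨β, hβ⟩ := hβ'
        rw [compForm_apply ε d q _ β hβ]
        by_contra hne
        have h1 := shiftedLetter_le_of_pairCoeff_ne_zero ε d hq hs₀ β β₀ hβ hβ₀ hne
        have h2 := hmax f ((hT f).2 ⟨hw, content_eq β hβ⟩)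
        have h3 := toLex.injective (le_antisymm h1 h2)
        refine hwne (congrArg List.ofFn (funext fun a => ?_))
        have h4 := congrArg ofLex (congrFun h3 a)
        simp only [shiftedLetter, ofLex_toLex, Prod.mk.injEq, add_left_inj] at h4
        exact Prod.ext h4.2.symm h4.1.symm
      · rw [compForm_eq_zero ε d q _ hβ']
        rfl
    · rw [compForm_eq_zero ε d q _ hβ]
      rfl
  · intro hw
    exact absurd hf₀.1 hw

theorem nondegenerate_of_isPairForm [CharZero K] {ε : ℤˣ} {d : Matrix I I ℤ} {q : K} (hq : q ≠ 0)
    {g : I × ℤ → A} (hg : IsQuadPresentation d q g) {B : A →ₗ[K] V K I →ₗ[K] K}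
    (hB : IsPairForm ε d q g B) : B.Nondegenerate :=
  ⟨separatingLeft_of_isPairForm hq hg hB, separatingRight_of_isPairForm hq hB⟩

theorem isPairingUV_iff {d : Matrix I I ℤ} (hd : ∀ i j, d i j = d j i) {q : K}
    {B : UPlus d q →ₗ[K] V K I →ₗ[K] K} :
    IsPairingUV d q B ↔ IsPairForm (-1) d q (fun x => e d q x.1 x.2) B := by
  simp only [IsPairingUV, IsPairForm, integralDesc_integrandPlus hd]

theorem isPairingVU_iff {d : Matrix I I ℤ} {q : K}
    {B : V K I →ₗ[K] UMinus d q →ₗ[K] K} :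
    IsPairingVU d q B ↔ IsPairForm 1 d q (fun x => f d q x.1 (-x.2)) B.flip := by
  simp only [IsPairingVU, IsPairForm, integralAsc_integrandMinus, LinearMap.flip_apply]

end Nondegeneracy

end QuantumLoop

theorem proposition2p5 {K : Type*} [Field K] [CharZero K] {I : Type*} [Fintype I] [LinearOrder I]
    (d : Matrix I I ℤ) (hd : QuantumLoop.IsSymmetricCartan d)
    (q : K) (hq0 : q ≠ 0) (hq : ∀ n : ℕ, 0 < n → q ^ n ≠ 1) :
    (∃ B : QuantumLoop.UPlus d q →ₗ[K] QuantumLoop.V K I →ₗ[K] K,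
      QuantumLoop.IsPairingUV d q B ∧
      (∀ B', QuantumLoop.IsPairingUV d q B' → B' = B) ∧
      B.Nondegenerate) ∧
    (∃ B : QuantumLoop.V K I →ₗ[K] QuantumLoop.UMinus d q →ₗ[K] K,
      QuantumLoop.IsPairingVU d q B ∧
      (∀ B', QuantumLoop.IsPairingVU d q B' → B' = B) ∧
      B.Nondegenerate) := by
  have he := QuantumLoop.isQuadPresentation_e d q
  have hf := QuantumLoop.isQuadPresentation_f d hq0
  constructor
  · obtain ⟨B, hB, huniq⟩ := QuantumLoop.existsUnique_isPairForm (-1) hd.symm hq0 he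
    exact ⟨B, (QuantumLoop.isPairingUV_iff hd.symm).2 hB,
      fun B' hB' => huniq B' ((QuantumLoop.isPairingUV_iff hd.symm).1 hB'),
      QuantumLoop.nondegenerate_of_isPairForm hq0 he hB⟩
  · obtain ⟨B, hB, huniq⟩ := QuantumLoop.existsUnique_isPairForm 1 hd.symm hq0 hf
    refine ⟨B.flip, QuantumLoop.isPairingVU_iff.2 hB, fun B' hB' => ?_,
      LinearMap.flip_nondegenerate.2 (QuantumLoop.nondegenerate_of_isPairForm hq0 hf hB)⟩
    rw [← huniq B'.flip (QuantumLoop.isPairingVU_iff.1 hB'), LinearMap.flip_flip]
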